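/- Let $m,n\ge 0$ and let $\mathfrak g'=\mathfrak{gl}_{m+n}(\mathbb C)$, written in block form. Put $$\mathfrak k'=\left\{\begin{pmatrix}X&0\\0&Y\end{pmatrix}\right\},\quad \mathfrak p^+=\left\{\begin{pmatrix}0&A\\0&0\end{pmatrix}\right\},\quad \mathfrak p^-=\left\{\begin{pmatrix}0&0\\B&0\end{pmatrix}\right\},\quad \mathfrak q'=\mathfrak k'+\mathfrak p^-,$$ with $X\in M_m(\mathbb C)$, $Y\in M_n(\mathbb C)$, $A\in M_{m,n}(\mathbb C)$, $B\in M_{n,m}(\mathbb C)$. Let $\mathfrak h=\mathfrak o(m,n,\mathbb C)=\{Z\in\mathfrak g' : Z^TJ+JZ=0\}$ with $J=\mathrm{diag}(I_m,-I_n)$. Then $\mathfrak h=\mathfrak k\oplus\mathfrak p$, where $\mathfrak k=\mathfrak k'\cap\mathfrak h\cong\mathfrak o_m(\mathbb C)\times\mathfrak o_n(\mathbb C)$ and $\mathfrak p=\left\{\begin{pmatrix}0&A\\A^T&0\end{pmatrix}\right\}$. Let $\varphi:\mathfrak p\to\mathfrak p^+$, $\begin{pmatrix}0&A\\A^T&0\end{pmatrix}\mapsto\begin{pmatrix}0&A\\0&0\end{pmatrix}$,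 a linear bijection, and let $S(\varphi):S(\mathfrak p)\to S(\mathfrak p^+)$ be the induced isomorphism of symmetric algebras. Write $\mathfrak U$ for universal enveloping algebras. Let $E$ be a finite-dimensional $\mathfrak k'$-module, made into a $\mathfrak q'$-module by letting $\mathfrak p^-$ act by zero. Put $$V_E=\mathfrak U(\mathfrak h)\otimes_{\mathfrak U(\mathfrak k)}E|_{\mathfrak k},\qquad V_E^+=\mathfrak U(\mathfrak g')\otimes_{\mathfrak U(\mathfrak q')}E,$$ and let $T:V_E\to V_E^+$ be the $\mathfrak U(\mathfrak h)$-linear map with $T(1\otimes e)=1\otimes e$ for $e\in E$, that is, $T(a\otimes e)=a\otimes e$ for $a\in\mathfrak U(\mathfrak h)\subset\mathfrak U(\mathfrak g')$. Filter $V_E$ by letting $(V_E)_k$ be the span of all $x_1\cdots x_r\otimes e$ with $r\le k$, $x_i\in\mathfrak p$, $e\in E$, and filter $V_E^+$ by letting $(V_E^+)_k$ be the span of all $y_1\cdots y_r\otimes e$ with $r\le k$, $y_i\in\mathfrak p^+$, $e\in E$. The associated graded space $Gr(V_E)=\bigoplus_k (V_E)_k/(V_E)_{k-1}$ is an $S(\mathfrak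 p)$-module, where $x\in\mathfrak p$ sends the class of $v$ in degree $k$ to the class of $xv$ in degree $k+1$; likewise $Gr(V_E^+)$ is an $S(\mathfrak p^+)$-module. Then: 1. $T$ is an isomorphism of $\mathfrak U(\mathfrak h)$-modules. 2. $T$ preserves the filtrations, and the induced map $T_G:Gr(V_E)\to Gr(V_E^+)$ is an isomorphism of $S(\mathfrak p)$-modules, where $S(\mathfrak p)$ acts on $Gr(V_E^+)$ through $S(\varphi)$. 3. The natural maps $S(\mathfrak p)\otimes E\to Gr(V_E)$ and $S(\mathfrak p^+)\otimes E\to Gr(V_E^+)$, $a\otimes e\mapsto a\cdot[1\otimes e]$, are bijective, and under these identifications $T_G$ is the map $S(\varphi)\otimes\mathrm{id}_E$ induced by $\varphi:\mathfrak p\cong\mathfrak p^+$. -/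

import Mathlib

open scoped TensorProduct DirectSum

/- The commutator bracket on an associative algebra (matrices, endomorphisms, enveloping
algebras). -/
attribute [local instance 100] LieRing.ofAssociativeRing

noncomputable section

namespace OscRestriction

/-! ### Filtrations and associated graded spaces -/

section Graded

variable {V W : Type*} [AddCommGroup V] [Module ℂ V] [AddCommGroup W] [Module ℂ W]

/-- `F (n - 1)`, with the convention `F (-1) = 0`. -/
def prev (F : ℕ → Submodule ℂ V) : ℕ → Submodule ℂ V
  | 0 => ⊥
  | n + 1 => F n

/-- The graded piece `F n / F (n - 1)`. -/
abbrev GrPiece (F : ℕ → Submodule ℂ V) (n : ℕ) : Type _ :=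
  ↥(F n) ⧸ (prev F n).submoduleOf (F n)

/-- The associated graded space `⨁ n, F n / F (n - 1)`. -/
abbrev Gr (F : ℕ → Submodule ℂ V) : Type _ := ⨁ n, GrPiece F n

/-- The symbol in degree `n` of an element of `F n`. -/
def symbol (F : ℕ → Submodule ℂ V) (n : ℕ) : ↥(F n) →ₗ[ℂ] Gr F :=
  DirectSum.lof ℂ ℕ (GrPiece F) n ∘ₗ ((prev F n).submoduleOf (F n)).mkQ

theorem prev_le_comap {F : ℕ → Submodule ℂ V} {G : ℕ → Submodule ℂ W} {T : V →ₗ[ℂ] W}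
    (hT : ∀ n, F n ≤ (G n).comap T) (n : ℕ) : prev F n ≤ (prev G n).comap T := by
  cases n with
  | zero => exact bot_le
  | succ n => exact hT n

/-- The map of associated graded spaces induced by a filtration preserving linear map. -/
def grMap {F : ℕ → Submodule ℂ V} {G : ℕ → Submodule ℂ W} (T : V →ₗ[ℂ] W)
    (hT : ∀ n, F n ≤ (G n).comap T) : Gr F →ₗ[ℂ] Gr G :=
  DirectSum.toModule ℂ ℕ (Gr G) fun n =>
    DirectSum.lof ℂ ℕ (GrPiece G) n ∘ₗ
      Submodule.mapQ _ _ (T.restrict (fun _ hv => hT n hv))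
        (fun v hv => prev_le_comap hT n (show (v : V) ∈ prev F n from hv))

theorem prev_le_comap_succ {F : ℕ → Submodule ℂ V} {D : V →ₗ[ℂ] V}
    (hD : ∀ n, F n ≤ (F (n + 1)).comap D) (n : ℕ) : prev F n ≤ (F n).comap D := by
  cases n with
  | zero => exact bot_le
  | succ n => exact hD n

/-- The degree one operator on the associated graded space induced by an operator which
maps `F n` into `F (n + 1)` for all `n`. -/
def grShift {F : ℕ → Submodule ℂ V} (D : V →ₗ[ℂ] V)
    (hD : ∀ n, F n ≤ (F (n + 1)).comap D) : Gr F →ₗ[ℂ] Gr F :=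
  DirectSum.toModule ℂ ℕ (Gr F) fun n =>
    DirectSum.lof ℂ ℕ (GrPiece F) (n + 1) ∘ₗ
      Submodule.mapQ _ _ (D.restrict (fun _ hv => hD n hv))
        (fun v hv => prev_le_comap_succ hD n (show (v : V) ∈ prev F n from hv))

theorem grMap_symbol {F : ℕ → Submodule ℂ V} {G : ℕ → Submodule ℂ W} (T : V →ₗ[ℂ] W)
    (hT : ∀ n, F n ≤ (G n).comap T) (n : ℕ) (v : F n) :
    grMap T hT (symbol F n v) = symbol G n ⟨T v, hT n v.2⟩ := by
  simp only [grMap, symbol, LinearMap.comp_apply, DirectSum.toModule_lof]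
  rfl

theorem grShift_symbol {F : ℕ → Submodule ℂ V} (D : V →ₗ[ℂ] V)
    (hD : ∀ n, F n ≤ (F (n + 1)).comap D) (n : ℕ) (v : F n) :
    grShift D hD (symbol F n v) = symbol F (n + 1) ⟨D v, hD n v.2⟩ := by
  simp only [grShift, symbol, LinearMap.comp_apply, DirectSum.toModule_lof]
  rfl

theorem gr_hom_ext {F : ℕ → Submodule ℂ V} {X : Type*} [AddCommMonoid X] [Module ℂ X]
    {f g : Gr F →ₗ[ℂ] X} (h : ∀ n (v : F n), f (symbol F n v) = g (symbol F n v)) : f = g := by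
  refine DirectSum.linearMap_ext ℂ fun n => LinearMap.ext fun q => ?_
  obtain ⟨v, rfl⟩ := Submodule.mkQ_surjective _ q
  exact h n v

theorem symbol_eq_of_sub_mem {F : ℕ → Submodule ℂ V} {n : ℕ} {v w : F n}
    (h : (v : V) - w ∈ prev F n) : symbol F n v = symbol F n w := by
  have : ((prev F n).submoduleOf (F n)).mkQ v = ((prev F n).submoduleOf (F n)).mkQ w :=
    (Submodule.Quotient.eq _).2 h
  simp only [symbol, LinearMap.comp_apply, this]

end Graded

/-! ### Symmetric algebras -/

section Symmetric

variable {M N X : Type*} [AddCommGroup M] [Module ℂ M] [AddCommGroup N] [Module ℂ N]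
  [AddCommMonoid X] [Module ℂ X]

/-- Commuting operators `g x` on `X`, depending linearly on `x : M`, make `X` a module over the
symmetric algebra of `M`. -/
def symLift (g : M →ₗ[ℂ] Module.End ℂ X) (hg : ∀ x y, g x * g y = g y * g x) :
    SymmetricAlgebra ℂ M →ₐ[ℂ] Module.End ℂ X :=
  RingCon.liftₐ _ (TensorAlgebra.lift ℂ g) <| by
    refine RingCon.ringConGen_le.2 fun a b h => ?_
    induction h with
    | mul_comm x y => simp [RingCon.ker_apply, hg x y]

theorem symLift_ι (g : M →ₗ[ℂ] Module.End ℂ X) (hg : ∀ x y, g x * g y = g y * g x) (x : M) :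
    symLift g hg (SymmetricAlgebra.ι ℂ M x) = g x := by
  change TensorAlgebra.lift ℂ g (TensorAlgebra.ι ℂ x) = g x
  simp

/-- The homomorphism of symmetric algebras induced by a linear map. -/
def symMap (φ : M →ₗ[ℂ] N) : SymmetricAlgebra ℂ M →ₐ[ℂ] SymmetricAlgebra ℂ N :=
  SymmetricAlgebra.lift (SymmetricAlgebra.ι ℂ N ∘ₗ φ)

end Symmetric

/-! ### Extension of scalars along a homomorphism of (noncommutative) algebras -/

section Ind

variable {A B E : Type*} [Ring A] [Algebra ℂ A] [Ring B] [Algebra ℂ B]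
  [AddCommGroup E] [Module ℂ E]

/-- The relations `a f(b) ⊗ e = a ⊗ b e` that define `A ⊗_B E`. -/
def balanced (f : B →ₐ[ℂ] A) (ρ : B →ₐ[ℂ] Module.End ℂ E) : Submodule A (A ⊗[ℂ] E) :=
  Submodule.span A {t | ∃ (a : A) (b : B) (e : E), t = (a * f b) ⊗ₜ[ℂ] e - a ⊗ₜ[ℂ] (ρ b e)}

/-- The left `A`-module `A ⊗_B E`, where `A` is a right `B`-module through `f` and `E` is the
left `B`-module given by `ρ`. -/
def Ind (f : B →ₐ[ℂ] A) (ρ : B →ₐ[ℂ] Module.End ℂ E) : Type _ := (A ⊗[ℂ] E) ⧸ balanced f ρ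

variable (f : B →ₐ[ℂ] A) (ρ : B →ₐ[ℂ] Module.End ℂ E)

instance : AddCommGroup (Ind f ρ) := inferInstanceAs (AddCommGroup ((A ⊗[ℂ] E) ⧸ balanced f ρ))

instance : Module A (Ind f ρ) := inferInstanceAs (Module A ((A ⊗[ℂ] E) ⧸ balanced f ρ))

instance : Module ℂ (Ind f ρ) := inferInstanceAs (Module ℂ ((A ⊗[ℂ] E) ⧸ balanced f ρ))

instance : IsScalarTower ℂ A (Ind f ρ) :=
  inferInstanceAs (IsScalarTower ℂ A ((A ⊗[ℂ] E) ⧸ balanced f ρ))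

/-- The element `a ⊗ e` of `A ⊗_B E`. -/
def Ind.mk (a : A) (e : E) : Ind f ρ := (balanced f ρ).mkQ (a ⊗ₜ[ℂ] e)

variable {f ρ}

theorem Ind.smul_mk (a a' : A) (e : E) : a • Ind.mk f ρ a' e = Ind.mk f ρ (a * a') e := by
  unfold Ind.mk
  exact (map_smul (balanced f ρ).mkQ a (a' ⊗ₜ[ℂ] e)).symm

theorem Ind.mk_mul (a : A) (b : B) (e : E) : Ind.mk f ρ (a * f b) e = Ind.mk f ρ a (ρ b e) :=
  (Submodule.Quotient.eq _).2 (Submodule.subset_span ⟨a, b, e, rfl⟩)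

variable (f ρ) in
/-- The map `E → A ⊗_B E`, `e ↦ a ⊗ e`. -/
def Ind.mkₗ (a : A) : E →ₗ[ℂ] Ind f ρ where
  toFun := Ind.mk f ρ a
  map_add' x y := by
    unfold Ind.mk
    rw [TensorProduct.tmul_add]; exact map_add (balanced f ρ).mkQ _ _
  map_smul' c x := by
    unfold Ind.mk
    rw [TensorProduct.tmul_smul]
    exact map_smul ((balanced f ρ).mkQ.restrictScalars ℂ) c (a ⊗ₜ[ℂ] x)

/-- Frobenius reciprocity: a `B`-linear map `g : E → N` into an `A`-module extends to the
`A`-linear map `A ⊗_B E → N`, `a ⊗ e ↦ a g(e)`. -/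
def Ind.lift {N : Type*} [AddCommGroup N] [Module ℂ N] [Module A N] [IsScalarTower ℂ A N]
    (g : E →ₗ[ℂ] N) (hg : ∀ b e, g (ρ b e) = f b • g e) : Ind f ρ →ₗ[A] N :=
  (balanced f ρ).liftQ
    (TensorProduct.AlgebraTensorModule.lift
      ((LinearMap.toSpanSingleton A (E →ₗ[ℂ] N) g)))
    (by
      refine Submodule.span_le.2 ?_
      rintro _ ⟨a, b, e, rfl⟩
      simp [hg, mul_smul])

theorem Ind.lift_mk {N : Type*} [AddCommGroup N] [Module ℂ N] [Module A N] [IsScalarTower ℂ A N]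
    (g : E →ₗ[ℂ] N) (hg : ∀ b e, g (ρ b e) = f b • g e) (a : A) (e : E) :
    Ind.lift g hg (Ind.mk f ρ a e) = a • g e := by
  unfold Ind.lift Ind.mk
  refine (Submodule.liftQ_apply _ _ _).trans ?_
  simp

end Ind

/-! ### Induced modules of Lie algebras, their filtrations and graded spaces -/

section LieInd

variable {L L' s E : Type*} [LieRing L] [LieAlgebra ℂ L] [LieRing L'] [LieAlgebra ℂ L']
  [LieRing s] [LieAlgebra ℂ s] [AddCommGroup E] [Module ℂ E]

/-- The universal enveloping algebra of a complex Lie algebra. -/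
abbrev U (L : Type*) [LieRing L] [LieAlgebra ℂ L] : Type _ := UniversalEnvelopingAlgebra ℂ L

/-- The homomorphism of enveloping algebras induced by a homomorphism of Lie algebras. -/
def uMap (i : s →ₗ⁅ℂ⁆ L) : U s →ₐ[ℂ] U L :=
  UniversalEnvelopingAlgebra.lift ℂ ((UniversalEnvelopingAlgebra.ι ℂ).comp i)

theorem uMap_ι (i : s →ₗ⁅ℂ⁆ L) (x : s) :
    uMap i (UniversalEnvelopingAlgebra.ι ℂ x) = UniversalEnvelopingAlgebra.ι ℂ (i x) :=
  UniversalEnvelopingAlgebra.lift_ι_apply ℂ _ x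

/-- The action of `U s` on a representation of `s`. -/
def uRep (τ : s →ₗ⁅ℂ⁆ Module.End ℂ E) : U s →ₐ[ℂ] Module.End ℂ E :=
  UniversalEnvelopingAlgebra.lift ℂ τ

theorem uRep_ι (τ : s →ₗ⁅ℂ⁆ Module.End ℂ E) (x : s) :
    uRep τ (UniversalEnvelopingAlgebra.ι ℂ x) = τ x :=
  UniversalEnvelopingAlgebra.lift_ι_apply ℂ _ x

theorem uMap_comp_apply (i : s →ₗ⁅ℂ⁆ L) (j : L →ₗ⁅ℂ⁆ L') (b : U s) :
    uMap j (uMap i b) = uMap (j.comp i) b := by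
  have : (uMap j).comp (uMap i) = uMap (j.comp i) := by
    refine UniversalEnvelopingAlgebra.hom_ext ℂ (LieHom.ext fun x => ?_)
    change uMap j (uMap i (UniversalEnvelopingAlgebra.ι ℂ x)) =
      uMap (j.comp i) (UniversalEnvelopingAlgebra.ι ℂ x)
    simp only [uMap_ι, LieHom.comp_apply]
  exact congrArg (fun f => f b) this

theorem uRep_uMap_apply (i : s →ₗ⁅ℂ⁆ L) (τ : L →ₗ⁅ℂ⁆ Module.End ℂ E) (b : U s) :
    uRep τ (uMap i b) = uRep (τ.comp i) b := by
  have : (uRep τ).comp (uMap i) = uRep (τ.comp i) := by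
    refine UniversalEnvelopingAlgebra.hom_ext ℂ (LieHom.ext fun x => ?_)
    change uRep τ (uMap i (UniversalEnvelopingAlgebra.ι ℂ x)) =
      uRep (τ.comp i) (UniversalEnvelopingAlgebra.ι ℂ x)
    simp only [uMap_ι, uRep_ι, LieHom.comp_apply]
  exact congrArg (fun f => f b) this

/-- The induced module `U(L) ⊗_{U(s)} E`. -/
abbrev LieInd (i : s →ₗ⁅ℂ⁆ L) (τ : s →ₗ⁅ℂ⁆ Module.End ℂ E) : Type _ := Ind (uMap i) (uRep τ)

/-- The `n`-th step of the filtration of `U(L) ⊗_{U(s)} E` defined by a subspace `P` of `L`: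
the span of the elements `x₁ ⋯ x_r ⊗ e` with `r ≤ n` and `x₁, …, x_r ∈ P`. (A right factor from
`U(s)` can be moved across the tensor sign, so it would not enlarge this span.) -/
def filt (P : Submodule ℂ L) (i : s →ₗ⁅ℂ⁆ L) (τ : s →ₗ⁅ℂ⁆ Module.End ℂ E) (n : ℕ) :
    Submodule ℂ (LieInd i τ) :=
  Submodule.span ℂ {v | ∃ (l : List P) (e : E), l.length ≤ n ∧
    v = Ind.mk (uMap i) (uRep τ)
      (l.map fun x => UniversalEnvelopingAlgebra.ι ℂ (x : L)).prod e}

/-- The compatibility of `P` with `s` which makes the operators of `P` commute on graded spaces: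
brackets of elements of `P` lie in `s` and map `P` into itself. -/
def BracketCondition (P : Submodule ℂ L) (i : s →ₗ⁅ℂ⁆ L) : Prop :=
  ∀ x ∈ P, ∀ y ∈ P, ∃ u : s, i u = ⁅x, y⁆ ∧ ∀ z ∈ P, ⁅i u, z⁆ ∈ P

variable {P : Submodule ℂ L} {i : s →ₗ⁅ℂ⁆ L} {τ : s →ₗ⁅ℂ⁆ Module.End ℂ E}

/-- The operator of an element of `L` on `U(L) ⊗_{U(s)} E`. -/
def act (i : s →ₗ⁅ℂ⁆ L) (τ : s →ₗ⁅ℂ⁆ Module.End ℂ E) : L →ₗ[ℂ] Module.End ℂ (LieInd i τ) :=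
  (Algebra.lsmul ℂ ℂ (LieInd i τ)).toLinearMap ∘ₗ
    (UniversalEnvelopingAlgebra.ι ℂ : L →ₗ⁅ℂ⁆ U L).toLinearMap

theorem act_apply (x : L) (v : LieInd i τ) :
    act i τ x v = UniversalEnvelopingAlgebra.ι ℂ x • v := rfl

theorem mk_mem_filt (l : List P) (e : E) {n : ℕ} (h : l.length ≤ n) :
    Ind.mk (uMap i) (uRep τ) (l.map fun x => UniversalEnvelopingAlgebra.ι ℂ (x : L)).prod e ∈
      filt P i τ n :=
  Submodule.subset_span ⟨l, e, h, rfl⟩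

theorem filt_mono {m n : ℕ} (h : m ≤ n) : filt P i τ m ≤ filt P i τ n := by
  refine Submodule.span_mono ?_
  rintro _ ⟨l, e, hl, rfl⟩
  exact ⟨l, e, hl.trans h, rfl⟩

theorem filt_le_comap_act (x : P) (n : ℕ) :
    filt P i τ n ≤ (filt P i τ (n + 1)).comap (act i τ (x : L)) := by
  refine Submodule.span_le.2 ?_
  rintro _ ⟨l, e, hl, rfl⟩
  have := mk_mem_filt (i := i) (τ := τ) (x :: l) e (n := n + 1) (by simpa using hl)
  simpa [act_apply, Ind.smul_mk] using this

theorem filt_le_comap_act_sub {u : s} (hu : ∀ z ∈ P, ⁅i u, z⁆ ∈ P) (n : ℕ) :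
    filt P i τ n ≤ (filt P i τ n).comap (act i τ (i u)) := by
  refine Submodule.span_le.2 ?_
  rintro _ ⟨l, e, hl, rfl⟩
  induction l generalizing n with
  | nil =>
    have h1 : act i τ (i u) (Ind.mk (uMap i) (uRep τ) 1 e) =
        Ind.mk (uMap i) (uRep τ) 1 (uRep τ (UniversalEnvelopingAlgebra.ι ℂ u) e) := by
      rw [act_apply, Ind.smul_mk, mul_one, ← Ind.mk_mul, one_mul, uMap_ι]
    have := mk_mem_filt (i := i) (τ := τ) (P := P) [] (uRep τ (UniversalEnvelopingAlgebra.ι ℂ u) e)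
      (n := n) (by simp)
    simpa [h1] using this
  | cons x l ih =>
    obtain ⟨k, rfl⟩ : ∃ k, n = k + 1 := ⟨n - 1, by simp at hl; omega⟩
    have hk : l.length ≤ k := by simpa using hl
    set w := Ind.mk (uMap i) (uRep τ)
      (l.map fun x => UniversalEnvelopingAlgebra.ι ℂ (x : L)).prod e with hw
    have h2 : Ind.mk (uMap i) (uRep τ)
        ((x :: l).map fun x => UniversalEnvelopingAlgebra.ι ℂ (x : L)).prod e =
        act i τ (x : L) w := by
      rw [act_apply, hw, Ind.smul_mk]; simp
    have h3 : act i τ (i u) (act i τ (x : L) w) =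
        act i τ ⁅i u, (x : L)⁆ w + act i τ (x : L) (act i τ (i u) w) := by
      simp only [act_apply, LieHom.map_lie, LieRing.of_associative_ring_bracket, sub_smul,
        mul_smul]
      abel
    have h4 := filt_le_comap_act (i := i) (τ := τ) ⟨_, hu x x.2⟩ k (mk_mem_filt l e hk)
    have h5 := filt_le_comap_act (i := i) (τ := τ) x k (ih k hk)
    simp only [SetLike.mem_coe, Submodule.mem_comap, h2, h3]
    exact add_mem h4 h5

/-- The degree one operator of an element of `P` on the associated graded space. -/
def grAct (P : Submodule ℂ L) (i : s →ₗ⁅ℂ⁆ L) (τ : s →ₗ⁅ℂ⁆ Module.End ℂ E) :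
    P →ₗ[ℂ] Module.End ℂ (Gr (filt P i τ)) where
  toFun x := grShift (act i τ (x : L)) (filt_le_comap_act x)
  map_add' x y := by
    refine gr_hom_ext fun n v => ?_
    rw [LinearMap.add_apply, grShift_symbol, grShift_symbol, grShift_symbol, ← map_add]
    congr 1
    ext
    simp
  map_smul' c x := by
    refine gr_hom_ext fun n v => ?_
    rw [LinearMap.smul_apply, grShift_symbol, grShift_symbol, RingHom.id_apply, ← map_smul]
    congr 1
    ext
    simp

theorem grAct_symbol (x : P) (n : ℕ) (v : filt P i τ n) :
    grAct P i τ x (symbol _ n v) =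
      symbol _ (n + 1) ⟨act i τ (x : L) v, filt_le_comap_act x n v.2⟩ :=
  grShift_symbol _ _ n v

theorem grAct_commute (hP : BracketCondition P i) (x y : P) :
    grAct P i τ x * grAct P i τ y = grAct P i τ y * grAct P i τ x := by
  refine gr_hom_ext fun n v => ?_
  rw [Module.End.mul_apply, Module.End.mul_apply, grAct_symbol, grAct_symbol, grAct_symbol,
    grAct_symbol]
  refine symbol_eq_of_sub_mem ?_
  obtain ⟨u, hu, hz⟩ := hP x x.2 y y.2
  have h : act i τ (x : L) (act i τ (y : L) (v : LieInd i τ)) -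
      act i τ (y : L) (act i τ (x : L) (v : LieInd i τ)) = act i τ (i u) (v : LieInd i τ) := by
    rw [hu]
    simp only [act_apply, LieHom.map_lie, LieRing.of_associative_ring_bracket, sub_smul,
      mul_smul]
  exact h ▸ filt_mono (Nat.le_succ n) (filt_le_comap_act_sub hz n v.2)

/-- The action of the symmetric algebra `S(P)` on the associated graded space: `x ∈ P` sends the
class of `v` in degree `n` to the class of `x v` in degree `n + 1`. -/
def grSym (hP : BracketCondition P i) (τ : s →ₗ⁅ℂ⁆ Module.End ℂ E) :
    SymmetricAlgebra ℂ P →ₐ[ℂ] Module.End ℂ (Gr (filt P i τ)) :=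
  symLift (grAct P i τ) (grAct_commute hP)

/-- The class of `1 ⊗ e` in degree `0` of the associated graded space. -/
def grOne (P : Submodule ℂ L) (i : s →ₗ⁅ℂ⁆ L) (τ : s →ₗ⁅ℂ⁆ Module.End ℂ E) :
    E →ₗ[ℂ] Gr (filt P i τ) :=
  symbol (filt P i τ) 0 ∘ₗ LinearMap.codRestrict (filt P i τ 0) (Ind.mkₗ (uMap i) (uRep τ) 1)
    (fun e => mk_mem_filt (P := P) (i := i) (τ := τ) [] e (n := 0) le_rfl)

/-- The natural map `S(P) ⊗ E → Gr`, `a ⊗ e ↦ a · [1 ⊗ e]`. -/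
def symToGr (hP : BracketCondition P i) (τ : s →ₗ⁅ℂ⁆ Module.End ℂ E) :
    SymmetricAlgebra ℂ P ⊗[ℂ] E →ₗ[ℂ] Gr (filt P i τ) :=
  TensorProduct.lift
    ((LinearMap.lcomp ℂ (Gr (filt P i τ)) (grOne P i τ)) ∘ₗ (grSym hP τ).toLinearMap)

theorem symToGr_tmul (hP : BracketCondition P i) (a : SymmetricAlgebra ℂ P) (e : E) :
    symToGr hP τ (a ⊗ₜ e) = grSym hP τ a (grOne P i τ e) := rfl

end LieInd

/-! ### The Lie algebras -/

section LieAlgebras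

open Matrix

/-- `𝔤' = gl_{m+n}(ℂ)`, as block matrices, with the commutator bracket. -/
abbrev gPrime (m n : ℕ) : Type := Matrix (Fin m ⊕ Fin n) (Fin m ⊕ Fin n) ℂ

theorem fromBlocks_sub' {m n : ℕ} (X X' : Matrix (Fin m) (Fin m) ℂ)
    (A A' : Matrix (Fin m) (Fin n) ℂ) (B B' : Matrix (Fin n) (Fin m) ℂ)
    (Y Y' : Matrix (Fin n) (Fin n) ℂ) :
    fromBlocks X A B Y - fromBlocks X' A' B' Y' =
      fromBlocks (X - X') (A - A') (B - B') (Y - Y') := by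
  ext (i | i) (j | j) <;> rfl

/-- `𝔨' = {(X 0; 0 Y)} ≅ gl_m(ℂ) × gl_n(ℂ)`. -/
def kPrime (m n : ℕ) : LieSubalgebra ℂ (gPrime m n) where
  carrier := {Z | ∃ (X : Matrix (Fin m) (Fin m) ℂ) (Y : Matrix (Fin n) (Fin n) ℂ),
    Z = fromBlocks X 0 0 Y}
  zero_mem' := ⟨0, 0, by simp⟩
  add_mem' := by
    rintro _ _ ⟨X, Y, rfl⟩ ⟨X', Y', rfl⟩
    exact ⟨X + X', Y + Y', by simp [fromBlocks_add]⟩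
  smul_mem' := by
    rintro c _ ⟨X, Y, rfl⟩
    exact ⟨c • X, c • Y, by simp [fromBlocks_smul]⟩
  lie_mem' := by
    rintro _ _ ⟨X, Y, rfl⟩ ⟨X', Y', rfl⟩
    exact ⟨⁅X, X'⁆, ⁅Y, Y'⁆, by
      simp [LieRing.of_associative_ring_bracket, fromBlocks_multiply, fromBlocks_sub']⟩

/-- `𝔭⁺ = {(0 A; 0 0)}`. -/
def pPlus (m n : ℕ) : Submodule ℂ (gPrime m n) where
  carrier := {Z | ∃ A : Matrix (Fin m) (Fin n) ℂ, Z = fromBlocks 0 A 0 0}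
  zero_mem' := ⟨0, by simp⟩
  add_mem' := by
    rintro _ _ ⟨A, rfl⟩ ⟨A', rfl⟩
    exact ⟨A + A', by simp [fromBlocks_add]⟩
  smul_mem' := by
    rintro c _ ⟨A, rfl⟩
    exact ⟨c • A, by simp [fromBlocks_smul]⟩

/-- `𝔮' = 𝔨' + 𝔭⁻ = {(X 0; B Y)}`. -/
def qPrime (m n : ℕ) : LieSubalgebra ℂ (gPrime m n) where
  carrier := {Z | ∃ (X : Matrix (Fin m) (Fin m) ℂ) (B : Matrix (Fin n) (Fin m) ℂ)
    (Y : Matrix (Fin n) (Fin n) ℂ), Z = fromBlocks X 0 B Y}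
  zero_mem' := ⟨0, 0, 0, by simp⟩
  add_mem' := by
    rintro _ _ ⟨X, B, Y, rfl⟩ ⟨X', B', Y', rfl⟩
    exact ⟨X + X', B + B', Y + Y', by simp [fromBlocks_add]⟩
  smul_mem' := by
    rintro c _ ⟨X, B, Y, rfl⟩
    exact ⟨c • X, c • B, c • Y, by simp [fromBlocks_smul]⟩
  lie_mem' := by
    rintro _ _ ⟨X, B, Y, rfl⟩ ⟨X', B', Y', rfl⟩
    exact ⟨⁅X, X'⁆, B * X' + Y * B' - (B' * X + Y' * B), ⁅Y, Y'⁆, by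
      simp [LieRing.of_associative_ring_bracket, fromBlocks_multiply, fromBlocks_sub']⟩

/-- The projection `𝔮' → 𝔨'`, `(X 0; B Y) ↦ (X 0; 0 Y)`, with kernel `𝔭⁻`. -/
def qToK (m n : ℕ) : qPrime m n →ₗ⁅ℂ⁆ kPrime m n where
  toFun Z := ⟨fromBlocks Z.1.toBlocks₁₁ 0 0 Z.1.toBlocks₂₂, _, _, rfl⟩
  map_add' Z Z' := by
    ext1
    ext (i | i) (j | j) <;> simp [toBlocks₁₁, toBlocks₂₂]
  map_smul' c Z := by
    ext1
    ext (i | i) (j | j) <;> simp [toBlocks₁₁, toBlocks₂₂]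
  map_lie' := by
    rintro ⟨_, X, B, Y, rfl⟩ ⟨_, X', B', Y', rfl⟩
    ext1
    simp [LieRing.of_associative_ring_bracket, fromBlocks_multiply, fromBlocks_sub']

/-- `𝔥 = o(m,n,ℂ)`: the matrices `Z` with `Zᵀ J = - J Z`, where `J = diag(1,…,1,-1,…,-1)`. -/
abbrev hAlg (m n : ℕ) : LieSubalgebra ℂ (gPrime m n) :=
  LieAlgebra.Orthogonal.so' (Fin m) (Fin n) ℂ

theorem mem_hAlg_iff {m n : ℕ} (X : Matrix (Fin m) (Fin m) ℂ) (A : Matrix (Fin m) (Fin n) ℂ)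
    (B : Matrix (Fin n) (Fin m) ℂ) (Y : Matrix (Fin n) (Fin n) ℂ) :
    fromBlocks X A B Y ∈ hAlg m n ↔ Xᵀ = -X ∧ B = Aᵀ ∧ Yᵀ = -Y := by
  have hJ : LieAlgebra.Orthogonal.indefiniteDiagonal (Fin m) (Fin n) ℂ =
      fromBlocks 1 0 0 (-1) := by
    rw [LieAlgebra.Orthogonal.indefiniteDiagonal, ← diagonal_one, ← diagonal_one, diagonal_neg,
      fromBlocks_diagonal]
  rw [hAlg, LieAlgebra.Orthogonal.so', mem_skewAdjointMatricesLieSubalgebra,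
    mem_skewAdjointMatricesSubmodule, Matrix.IsSkewAdjoint, Matrix.IsAdjointPair, hJ,
    fromBlocks_transpose, fromBlocks_neg, fromBlocks_multiply, fromBlocks_multiply,
    fromBlocks_inj]
  simp only [Matrix.mul_one, Matrix.one_mul, Matrix.mul_zero, Matrix.zero_mul, Matrix.mul_neg,
    Matrix.neg_mul, neg_neg, neg_zero, add_zero, zero_add]
  constructor
  · rintro ⟨h1, h2, h3, h4⟩
    exact ⟨h1, h3.symm, neg_eq_iff_eq_neg.1 h4⟩
  · rintro ⟨h1, rfl, h3⟩
    exact ⟨h1, by simp, rfl, by rw [h3, neg_neg]⟩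

/-- `𝔨 = 𝔨' ∩ 𝔥`. -/
abbrev kAlg (m n : ℕ) : LieSubalgebra ℂ (gPrime m n) := kPrime m n ⊓ hAlg m n

/-- `𝔨` is `{(X 0; 0 Y) | X ∈ o_m(ℂ), Y ∈ o_n(ℂ)} ≅ o_m(ℂ) × o_n(ℂ)`. -/
theorem mem_kAlg_iff {m n : ℕ} (Z : gPrime m n) :
    Z ∈ kAlg m n ↔ ∃ X ∈ LieAlgebra.Orthogonal.so (Fin m) ℂ,
      ∃ Y ∈ LieAlgebra.Orthogonal.so (Fin n) ℂ, Z = fromBlocks X 0 0 Y := by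
  simp only [LieAlgebra.Orthogonal.mem_so]
  constructor
  · rintro ⟨⟨X, Y, rfl⟩, h⟩
    have := (mem_hAlg_iff _ _ _ _).1 h
    exact ⟨X, this.1, Y, this.2.2, rfl⟩
  · rintro ⟨X, hX, Y, hY, rfl⟩
    exact ⟨⟨X, Y, rfl⟩, (mem_hAlg_iff _ _ _ _).2 ⟨hX, by simp, hY⟩⟩

/-- `𝔭 = {(0 A; Aᵀ 0)} ⊆ 𝔥`. -/
def pAlg (m n : ℕ) : Submodule ℂ (hAlg m n) where
  carrier := {Z | ∃ A : Matrix (Fin m) (Fin n) ℂ, (Z : gPrime m n) = fromBlocks 0 A Aᵀ 0}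
  zero_mem' := ⟨0, by simp⟩
  add_mem' := by
    rintro Z Z' ⟨A, h⟩ ⟨A', h'⟩
    exact ⟨A + A', by simp [h, h', fromBlocks_add]⟩
  smul_mem' := by
    rintro c Z ⟨A, h⟩
    exact ⟨c • A, by simp [h, fromBlocks_smul]⟩

/-- The bijection `𝔭 → 𝔭' → 𝔭⁺`, inclusion followed by projection:
`(0 A; Aᵀ 0) ↦ (0 A; 0 0)`. -/
def pEquiv (m n : ℕ) : pAlg m n ≃ₗ[ℂ] pPlus m n where
  toFun Z := ⟨fromBlocks 0 Z.1.1.toBlocks₁₂ 0 0, _, rfl⟩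
  invFun Z := ⟨⟨fromBlocks 0 Z.1.toBlocks₁₂ Z.1.toBlocks₁₂ᵀ 0,
    (mem_hAlg_iff _ _ _ _).2 ⟨by simp, rfl, by simp⟩⟩, _, rfl⟩
  map_add' Z Z' := by
    ext1
    ext (i | i) (j | j) <;> simp [toBlocks₁₂]
  map_smul' c Z := by
    ext1
    ext (i | i) (j | j) <;> simp [toBlocks₁₂]
  left_inv := by
    rintro ⟨⟨Z, hZ⟩, A, h⟩
    obtain rfl : Z = fromBlocks 0 A Aᵀ 0 := h
    rfl
  right_inv := by
    rintro ⟨_, A, rfl⟩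
    rfl

theorem bracketCondition_p (m n : ℕ) :
    BracketCondition (pAlg m n)
      (LieSubalgebra.inclusion (inf_le_right : kAlg m n ≤ hAlg m n)) := by
  rintro ⟨_, hx⟩ ⟨A, rfl⟩ ⟨_, hy⟩ ⟨B, rfl⟩
  have hxy : ⁅fromBlocks 0 A Aᵀ 0, fromBlocks 0 B Bᵀ 0⁆ =
      (fromBlocks (A * Bᵀ - B * Aᵀ) 0 0 (Aᵀ * B - Bᵀ * A) : gPrime m n) := by
    simp [LieRing.of_associative_ring_bracket, fromBlocks_multiply, fromBlocks_sub']
  refine ⟨⟨⁅fromBlocks 0 A Aᵀ 0, fromBlocks 0 B Bᵀ 0⁆, ⟨_, _, hxy⟩,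
    (hAlg m n).lie_mem hx hy⟩, rfl, ?_⟩
  rintro ⟨_, hz⟩ ⟨C, rfl⟩
  refine ⟨(A * Bᵀ - B * Aᵀ) * C - C * (Aᵀ * B - Bᵀ * A), ?_⟩
  change ⁅⁅fromBlocks 0 A Aᵀ 0, fromBlocks 0 B Bᵀ 0⁆, (fromBlocks 0 C Cᵀ 0 : gPrime m n)⁆ = _
  rw [hxy]
  simp [LieRing.of_associative_ring_bracket, fromBlocks_multiply, fromBlocks_sub',
    Matrix.mul_sub, Matrix.sub_mul, Matrix.mul_assoc]
  abel

theorem bracketCondition_pPlus (m n : ℕ) :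
    BracketCondition (pPlus m n) (qPrime m n).incl := by
  rintro _ ⟨A, rfl⟩ _ ⟨B, rfl⟩
  refine ⟨0, ?_, fun z _ => ?_⟩
  · simp [LieRing.of_associative_ring_bracket, fromBlocks_multiply]
  · simp

end LieAlgebras

/-! ### The modules `V_E`, `V_E⁺` and the map `T` -/

section Modules

variable (m n : ℕ) (E : Type*) [AddCommGroup E] [Module ℂ E]
  [LieRingModule (kPrime m n) E] [LieModule ℂ (kPrime m n) E]

/-- The restriction of the `𝔨'`-module `E` to `𝔨`. -/
abbrev repK : kAlg m n →ₗ⁅ℂ⁆ Module.End ℂ E :=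
  (LieModule.toEnd ℂ (kPrime m n) E).comp
    (LieSubalgebra.inclusion (inf_le_left : kAlg m n ≤ kPrime m n))

/-- The `𝔨'`-module `E` as a `𝔮'`-module on which `𝔭⁻` acts by zero. -/
abbrev repQ : qPrime m n →ₗ⁅ℂ⁆ Module.End ℂ E :=
  (LieModule.toEnd ℂ (kPrime m n) E).comp (qToK m n)

/-- `V_E = U(𝔥) ⊗_{U(𝔨)} E|_𝔨`. -/
abbrev VE : Type _ :=
  LieInd (LieSubalgebra.inclusion (inf_le_right : kAlg m n ≤ hAlg m n)) (repK m n E)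

/-- `V_E⁺ = U(𝔤') ⊗_{U(𝔮')} E`. -/
abbrev VPlus : Type _ := LieInd (qPrime m n).incl (repQ m n E)

/-- The restriction of `V_E⁺` to a `U(𝔥)`-module. -/
instance : Module (U (hAlg m n)) (VPlus m n E) :=
  Module.compHom (VPlus m n E) (uMap (hAlg m n).incl).toRingHom

theorem VPlus_smul_def (a : U (hAlg m n)) (v : VPlus m n E) :
    a • v = uMap (hAlg m n).incl a • v := rfl

instance : IsScalarTower ℂ (U (hAlg m n)) (VPlus m n E) where
  smul_assoc c a v := by
    rw [VPlus_smul_def, VPlus_smul_def, map_smul, smul_assoc]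

theorem mk_one_repK (b : U (kAlg m n)) (e : E) :
    Ind.mkₗ (uMap (qPrime m n).incl) (uRep (repQ m n E)) 1 (uRep (repK m n E) b e) =
      uMap (LieSubalgebra.inclusion (inf_le_right : kAlg m n ≤ hAlg m n)) b •
        Ind.mkₗ (uMap (qPrime m n).incl) (uRep (repQ m n E)) 1 e := by
  let j : kAlg m n →ₗ⁅ℂ⁆ qPrime m n := LieSubalgebra.inclusion (by
    rintro _ ⟨⟨X, Y, rfl⟩, -⟩
    exact ⟨X, 0, Y, rfl⟩)
  have h1 : (repQ m n E).comp j = repK m n E := by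
    refine LieHom.ext fun Z => ?_
    obtain ⟨_, ⟨X, Y, rfl⟩, h⟩ := Z
    rfl
  have h2 : (hAlg m n).incl.comp
      (LieSubalgebra.inclusion (inf_le_right : kAlg m n ≤ hAlg m n)) =
      (qPrime m n).incl.comp j := rfl
  change Ind.mk _ _ 1 _ = _ • Ind.mk _ _ 1 e
  rw [VPlus_smul_def, uMap_comp_apply, h2, ← uMap_comp_apply, ← h1, ← uRep_uMap_apply,
    ← Ind.mk_mul, Ind.smul_mk, one_mul, mul_one]

/-- The natural map `T : V_E → V_E⁺` of `U(𝔥)`-modules: the one which Frobenius reciprocity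
attaches to the `U(𝔨)`-linear map `E|_𝔨 → V_E⁺`, `e ↦ 1 ⊗ e`. -/
def mapT : VE m n E →ₗ[U (hAlg m n)] VPlus m n E :=
  Ind.lift (Ind.mkₗ (uMap (qPrime m n).incl) (uRep (repQ m n E)) 1) (mk_one_repK m n E)

/-- `T (a ⊗ e) = a ⊗ e`. -/
theorem mapT_mk (a : U (hAlg m n)) (e : E) :
    mapT m n E (Ind.mk _ _ a e) = Ind.mk _ _ (uMap (hAlg m n).incl a) e := by
  refine (Ind.lift_mk _ _ a e).trans ?_
  rw [VPlus_smul_def]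
  change _ • Ind.mk _ _ 1 e = _
  rw [Ind.smul_mk, mul_one]

/-- The filtration `(V_E)_k` by degree in `𝔭`. -/
abbrev filtV : ℕ → Submodule ℂ (VE m n E) :=
  filt (pAlg m n) (LieSubalgebra.inclusion (inf_le_right : kAlg m n ≤ hAlg m n)) (repK m n E)

/-- The filtration `(V_E⁺)_k` by degree in `𝔭⁺`. -/
abbrev filtVPlus : ℕ → Submodule ℂ (VPlus m n E) :=
  filt (pPlus m n) (qPrime m n).incl (repQ m n E)

/-- The `S(𝔭)`-module structure of `Gr(V_E)`. -/
abbrev symActV : SymmetricAlgebra ℂ (pAlg m n) →ₐ[ℂ] Module.End ℂ (Gr (filtV m n E)) :=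
  grSym (bracketCondition_p m n) (repK m n E)

/-- The `S(𝔭⁺)`-module structure of `Gr(V_E⁺)`. -/
abbrev symActVPlus : SymmetricAlgebra ℂ (pPlus m n) →ₐ[ℂ] Module.End ℂ (Gr (filtVPlus m n E)) :=
  grSym (bracketCondition_pPlus m n) (repQ m n E)

/-- The natural map `S(𝔭) ⊗ E → Gr(V_E)`, `a ⊗ e ↦ a · [1 ⊗ e]`. -/
abbrev symToGrV : SymmetricAlgebra ℂ (pAlg m n) ⊗[ℂ] E →ₗ[ℂ] Gr (filtV m n E) :=
  symToGr (bracketCondition_p m n) (repK m n E)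

/-- The natural map `S(𝔭⁺) ⊗ E → Gr(V_E⁺)`, `a ⊗ e ↦ a · [1 ⊗ e]`. -/
abbrev symToGrVPlus : SymmetricAlgebra ℂ (pPlus m n) ⊗[ℂ] E →ₗ[ℂ] Gr (filtVPlus m n E) :=
  symToGr (bracketCondition_pPlus m n) (repQ m n E)

end Modules

end OscRestriction

end

/-! The obstruction is `𝔥`: its complement `𝔭` is not abelian, so `Gr(V_E)` is not easily computed
directly. The parabolic side is easier, since `𝔭⁺` is abelian and `ad(𝔭⁺)³ = 0`. There `V_E⁺` has an
explicit model on `ℂ[x] ⊗ E`: elements of `𝔭⁺` multiply by linear forms, and all of `𝔤'` acts by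
differential operators of order at most two (`secondOrder`, `polyAct_lie`). Frobenius reciprocity
maps `V_E⁺` to this model, and taking leading terms shows that `S(𝔭⁺) ⊗ E → Gr(V_E⁺)` is injective
(`symToGr_injective`). This replaces the Poincaré–Birkhoff–Witt theorem. Surjectivity of `S(P) ⊗ E →
Gr` is formal on both sides (`symToGr_surjective`).

An element `x ∈ 𝔭` differs from `φ(x)` by an element of `𝔭⁻ ⊆ 𝔮'`, which does not raise the
filtration degree of `V_E⁺`. Hence `T_G` intertwines `x` with `φ(x)`, and `T_G` composed with `S(𝔭)
⊗ E → Gr(V_E)` is `S(φ) ⊗ id` followed by the bijection onto `Gr(V_E⁺)`. The composite is bijective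
and its first factor is surjective, so both factors are bijective. Both filtrations are exhaustive
and start from zero, so bijectivity of `T_G` gives that of `T`. -/

noncomputable section

namespace OscRestriction

/-! ### Passing from associated graded spaces back to filtered spaces. -/

section Graded

variable {V W : Type*} [AddCommGroup V] [Module ℂ V] [AddCommGroup W] [Module ℂ W]

theorem symbol_eq_zero_iff {F : ℕ → Submodule ℂ V} {n : ℕ} {v : F n} :
    symbol F n v = 0 ↔ (v : V) ∈ prev F n := by
  have hinj : Function.Injective (DirectSum.lof ℂ ℕ (GrPiece F) n) := DirectSum.of_injective n
  rw [symbol, LinearMap.comp_apply, map_eq_zero_iff _ hinj, Submodule.mkQ_apply,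
    Submodule.Quotient.mk_eq_zero]
  rfl

/-- The induced map is homogeneous of degree zero. This allows a preimage of a symbol to be replaced
by its component of the same degree. -/
theorem grMap_apply_component {F : ℕ → Submodule ℂ V} {G : ℕ → Submodule ℂ W} (T : V →ₗ[ℂ] W)
    (hT : ∀ n, F n ≤ (G n).comap T) (n : ℕ) (y : Gr F) :
    DirectSum.lof ℂ ℕ (GrPiece G) n (grMap T hT y n) =
      grMap T hT (DirectSum.lof ℂ ℕ (GrPiece F) n (y n)) := by
  induction y using DirectSum.induction_on with
  | zero => simp
  | add x y hx hy => simp only [map_add, DirectSum.add_apply, hx, hy]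
  | of k q =>
    obtain ⟨v, rfl⟩ := Submodule.mkQ_surjective _ q
    change DirectSum.lof ℂ ℕ (GrPiece G) n (grMap T hT (symbol F k v) n) = grMap T hT
      (DirectSum.lof ℂ ℕ (GrPiece F) n (symbol F k v n))
    rw [grMap_symbol]
    rcases eq_or_ne k n with rfl | h
    · simp only [symbol, LinearMap.comp_apply, DirectSum.lof_apply]
      exact (grMap_symbol T hT k v).symm
    · have h1 : symbol F k v n = 0 := DirectSum.of_eq_of_ne _ _ _ h.symm
      have h2 : symbol G k ⟨T v, hT k v.2⟩ n = 0 := DirectSum.of_eq_of_ne _ _ _ h.symm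
      rw [h1, h2, map_zero, map_zero, map_zero]

/-- If `T v = 0`, the symbol of `v` in any degree is killed by an injective map, so `v` drops one
filtration step at a time until it reaches `F (-1) = 0`. -/
theorem injective_of_grMap_injective {F : ℕ → Submodule ℂ V} {G : ℕ → Submodule ℂ W}
    (T : V →ₗ[ℂ] W) (hT : ∀ n, F n ≤ (G n).comap T) (hF : ∀ v, ∃ n, v ∈ F n)
    (h : Function.Injective (grMap T hT)) : Function.Injective T := by
  refine (injective_iff_map_eq_zero T).2 fun v hv => ?_
  obtain ⟨n, hn⟩ := hF v
  have key (n : ℕ) (hn : v ∈ F n) : v ∈ prev F n := by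
    refine (symbol_eq_zero_iff (v := ⟨v, hn⟩)).1 (h ?_)
    rw [grMap_symbol, map_zero, symbol_eq_zero_iff]
    simp [hv]
  induction n with
  | zero => exact (Submodule.mem_bot ℂ).1 (key 0 hn)
  | succ n ih => exact ih (key (n + 1) hn)

/-- Successive approximation: lifting the symbol of `w` leaves an error one step lower in the
filtration, and the process stops because `G (-1) = 0`. -/
theorem surjective_of_grMap_surjective {F : ℕ → Submodule ℂ V} {G : ℕ → Submodule ℂ W}
    (T : V →ₗ[ℂ] W) (hT : ∀ n, F n ≤ (G n).comap T) (hG : ∀ w, ∃ n, w ∈ G n)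
    (h : Function.Surjective (grMap T hT)) : Function.Surjective T := by
  have key (n : ℕ) (w : W) (hw : w ∈ G n) : ∃ v, w - T v ∈ prev G n := by
    obtain ⟨y, hy⟩ := h (symbol G n ⟨w, hw⟩)
    obtain ⟨v, hv⟩ := Submodule.mkQ_surjective _ (y n)
    refine ⟨v, ?_⟩
    have h1 := grMap_apply_component T hT n y
    rw [hy, ← hv] at h1
    have h2 : symbol G n ⟨w, hw⟩ n = ((prev G n).submoduleOf (G n)).mkQ ⟨w, hw⟩ :=
      DirectSum.of_eq_same _ _
    rw [h2] at h1
    change symbol G n ⟨w, hw⟩ = grMap T hT (symbol F n v) at h1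
    rw [grMap_symbol, ← sub_eq_zero] at h1
    exact symbol_eq_zero_iff.1 ((map_sub (symbol G n) _ _).trans h1)
  intro w
  obtain ⟨n, hn⟩ := hG w
  induction n generalizing w with
  | zero =>
    obtain ⟨v, hv⟩ := key 0 w hn
    exact ⟨v, (sub_eq_zero.1 ((Submodule.mem_bot ℂ).1 hv)).symm⟩
  | succ n ih =>
    obtain ⟨v, hv⟩ := key (n + 1) w hn
    obtain ⟨v', hv'⟩ := ih (w - T v) hv
    exact ⟨v' + v, by rw [map_add, hv', sub_add_cancel]⟩

end Graded

/-! ### Filtrations of induced modules: exhaustion, and generation of the graded space. -/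

theorem U_induction {L : Type*} [LieRing L] [LieAlgebra ℂ L] {p : U L → Prop}
    (algebraMap : ∀ c : ℂ, p (algebraMap ℂ (U L) c))
    (ι : ∀ x, p (UniversalEnvelopingAlgebra.ι ℂ x))
    (mul : ∀ a b, p a → p b → p (a * b)) (add : ∀ a b, p a → p b → p (a + b)) (a : U L) :
    p a := by
  obtain ⟨t, rfl⟩ : ∃ t, UniversalEnvelopingAlgebra.mkAlgHom ℂ L t = a :=
    Quotient.exists_rep a
  induction t using TensorAlgebra.induction with
  | algebraMap c => rw [AlgHom.commutes]; exact algebraMap c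
  | ι x => exact ι x
  | mul x y hx hy => rw [map_mul]; exact mul _ _ hx hy
  | add x y hx hy => rw [map_add]; exact add _ _ hx hy

section LieInd

variable {L s E : Type*} [LieRing L] [LieAlgebra ℂ L]
  [LieRing s] [LieAlgebra ℂ s] [AddCommGroup E] [Module ℂ E]
  {P : Submodule ℂ L} {i : s →ₗ⁅ℂ⁆ L} {τ : s →ₗ⁅ℂ⁆ Module.End ℂ E}

theorem act_mk (x : L) (a : U L) (e : E) :
    act i τ x (Ind.mk (uMap i) (uRep τ) a e) =
      Ind.mk (uMap i) (uRep τ) (UniversalEnvelopingAlgebra.ι ℂ x * a) e :=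
  Ind.smul_mk _ _ _

theorem act_lie (x y : L) (w : LieInd i τ) :
    act i τ x (act i τ y w) = act i τ y (act i τ x w) + act i τ ⁅x, y⁆ w := by
  simp only [act_apply, LieHom.map_lie, LieRing.of_associative_ring_bracket, sub_smul, mul_smul]
  abel

theorem prod_map_ι_cons (x : P) (l : List P) :
    ((x :: l).map fun x => UniversalEnvelopingAlgebra.ι ℂ (x : L)).prod =
      UniversalEnvelopingAlgebra.ι ℂ (x : L) *
        (l.map fun x => UniversalEnvelopingAlgebra.ι ℂ (x : L)).prod := by
  simp

/-- If `L = P + i(s)`, then `s` preserves the filtration. -/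
theorem filt_le_comap_act_of_decomp (hdec : ∀ x : L, ∃ p ∈ P, ∃ u, x = p + i u) (u : s) (n : ℕ) :
    filt P i τ n ≤ (filt P i τ n).comap (act i τ (i u)) := by
  refine Submodule.span_le.2 ?_
  rintro _ ⟨l, e, hl, rfl⟩
  induction l generalizing n u with
  | nil =>
    have h1 : act i τ (i u) (Ind.mk (uMap i) (uRep τ) 1 e) =
        Ind.mk (uMap i) (uRep τ) 1 (uRep τ (UniversalEnvelopingAlgebra.ι ℂ u) e) := by
      rw [act_apply, Ind.smul_mk, mul_one, ← Ind.mk_mul, one_mul, uMap_ι]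
    have := mk_mem_filt (i := i) (τ := τ) (P := P) []
      (uRep τ (UniversalEnvelopingAlgebra.ι ℂ u) e) (n := n) (by simp)
    simpa [h1] using this
  | cons x l ih =>
    obtain ⟨k, rfl⟩ : ∃ k, n = k + 1 := ⟨n - 1, by simp at hl; omega⟩
    have hk : l.length ≤ k := by simpa using hl
    -- Commuting `u` past `x` leaves the bracket, which may have a component `u'` in `s` different
    -- from `u`; the induction is therefore over all elements of `s` at once.
    obtain ⟨p, hp, u', hu'⟩ := hdec ⁅i u, (x : L)⁆
    rw [SetLike.mem_coe, Submodule.mem_comap, prod_map_ι_cons, ← act_mk, act_lie, hu', map_add, LinearMap.add_apply]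
    exact add_mem (filt_le_comap_act x k (ih u k hk))
      (add_mem (filt_le_comap_act ⟨p, hp⟩ k (mk_mem_filt l e hk))
        (filt_mono (Nat.le_succ k) (ih u' k hk)))

theorem act_mem_filt_succ (hdec : ∀ x : L, ∃ p ∈ P, ∃ u, x = p + i u) (x : L) {n : ℕ}
    {v : LieInd i τ} (hv : v ∈ filt P i τ n) : act i τ x v ∈ filt P i τ (n + 1) := by
  obtain ⟨p, hp, u, rfl⟩ := hdec x
  rw [map_add, LinearMap.add_apply]
  exact add_mem (filt_le_comap_act ⟨p, hp⟩ n hv)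
    (filt_mono (Nat.le_succ n) (filt_le_comap_act_of_decomp hdec u n hv))

/-- The module is generated from the vectors `1 ⊗ e` of degree `0`, and each element of `L` raises
the degree by at most one. -/
theorem exists_mem_filt (hdec : ∀ x : L, ∃ p ∈ P, ∃ u, x = p + i u) (v : LieInd i τ) :
    ∃ n, v ∈ filt P i τ n := by
  have key (a : U L) : ∀ (n : ℕ) (w : LieInd i τ), w ∈ filt P i τ n →
      ∃ k, a • w ∈ filt P i τ k := by
    induction a using U_induction with
    | algebraMap c =>
      exact fun n w hw => ⟨n, by rw [algebraMap_smul]; exact (filt P i τ n).smul_mem c hw⟩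
    | ι x => exact fun n w hw => ⟨n + 1, act_mem_filt_succ hdec x hw⟩
    | mul a b ha hb =>
      intro n w hw
      obtain ⟨k, hk⟩ := hb n w hw
      obtain ⟨j, hj⟩ := ha k _ hk
      exact ⟨j, by rwa [mul_smul]⟩
    | add a b ha hb =>
      intro n w hw
      obtain ⟨k, hk⟩ := ha n w hw
      obtain ⟨j, hj⟩ := hb n w hw
      exact ⟨max k j, by
        rw [add_smul]
        exact add_mem (filt_mono (le_max_left _ _) hk) (filt_mono (le_max_right _ _) hj)⟩
  obtain ⟨t, rfl⟩ := Submodule.mkQ_surjective _ v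
  induction t using TensorProduct.induction_on with
  | zero => exact ⟨0, by rw [map_zero]; exact zero_mem _⟩
  | tmul a e =>
    obtain ⟨k, hk⟩ := key a 0 _ (mk_mem_filt (i := i) (τ := τ) (P := P) [] e (n := 0) le_rfl)
    refine ⟨k, ?_⟩
    rw [Ind.smul_mk] at hk
    change Ind.mk (uMap i) (uRep τ) a e ∈ _
    simpa using hk
  | add x y hx hy =>
    obtain ⟨k, hk⟩ := hx
    obtain ⟨j, hj⟩ := hy
    exact ⟨max k j, by
      rw [map_add]
      exact add_mem (filt_mono (le_max_left _ _) hk) (filt_mono (le_max_right _ _) hj)⟩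

/-- Monomials of `S(P)` produce exactly the symbols of the spanning vectors of the filtration. -/
theorem grSym_list_prod (hP : BracketCondition P i) (l : List P) (e : E) :
    grSym hP τ (l.map (SymmetricAlgebra.ι ℂ P)).prod (grOne P i τ e) =
      symbol _ l.length ⟨_, mk_mem_filt l e le_rfl⟩ := by
  induction l with
  | nil =>
    simp only [List.map_nil, List.prod_nil, map_one, Module.End.one_apply]
    rfl
  | cons x l ih =>
    rw [List.map_cons, List.prod_cons, map_mul, Module.End.mul_apply, ih]
    rw [grSym, symLift_ι, grAct_symbol]
    congr 1

theorem symToGr_surjective (hP : BracketCondition P i) (τ : s →ₗ⁅ℂ⁆ Module.End ℂ E) :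
    Function.Surjective (symToGr hP τ) := by
  rw [← LinearMap.range_eq_top, eq_top_iff]
  have key (n : ℕ) (v : filt P i τ n) : symbol _ n v ∈ LinearMap.range (symToGr hP τ) := by
    obtain ⟨v, hv⟩ := v
    induction hv using Submodule.span_induction with
    | mem v h =>
      obtain ⟨l, e, hl, rfl⟩ := h
      -- A product with fewer than `n` factors already lies in the previous step, so its symbol in
      -- degree `n` is zero.
      rcases hl.lt_or_eq with hlt | rfl
      · have : symbol (filt P i τ) n ⟨_, Submodule.subset_span ⟨l, e, hl, rfl⟩⟩ = 0 := by
          obtain ⟨k, rfl⟩ : ∃ k, n = k + 1 := ⟨n - 1, by omega⟩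
          exact symbol_eq_zero_iff.2 (mk_mem_filt l e (Nat.le_of_lt_succ hlt))
        rw [this]
        exact zero_mem _
      · exact ⟨(l.map (SymmetricAlgebra.ι ℂ P)).prod ⊗ₜ e, by
          rw [symToGr_tmul, grSym_list_prod]⟩
    | zero =>
      rw [show (⟨0, _⟩ : filt P i τ n) = 0 from rfl, map_zero]
      exact zero_mem _
    | add x y hx hy h1 h2 =>
      have := add_mem h1 h2
      rwa [← map_add] at this
    | smul c x hx h =>
      have := Submodule.smul_mem _ c h
      rwa [← map_smul] at this
  rintro y -
  induction y using DirectSum.induction_on with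
  | zero => exact zero_mem _
  | add x y hx hy => exact add_mem hx hy
  | of k q =>
    obtain ⟨v, rfl⟩ := Submodule.mkQ_surjective _ q
    exact key k v

end LieInd


/-! ### Second order differential operators attached to an abelian subspace. -/

section SecondOrder

variable {L σ A : Type*} [LieRing L] [LieAlgebra ℂ L] [Ring A] [Algebra ℂ A] [Fintype σ]

/-- The second order differential operator with coefficients given by `φ`. -/
def secondOrder (φ : L →ₗ[ℂ] A) (y : σ → L) (d : σ → A) : L →ₗ[ℂ] A where
  -- This is the Taylor formula for moving `z` to the right past a polynomial `f` in commuting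
  -- elements `y a`: `z f = f z + ∑ (∂ₐf) [z, yₐ] + ½ ∑ (∂ₐ∂ₐ'f) [[z, yₐ], yₐ'] + ⋯`. It ends at
  -- order two when triple brackets with the `y a` vanish.
  toFun z := φ z + ∑ a, φ ⁅z, y a⁆ * d a +
    (2⁻¹ : ℂ) • ∑ a, ∑ a', φ ⁅⁅z, y a⁆, y a'⁆ * (d a * d a')
  map_add' x y := by
    simp only [add_lie, map_add, add_mul, Finset.sum_add_distrib, smul_add]
    abel
  map_smul' c x := by
    simp only [smul_lie, map_smul, smul_mul_assoc, RingHom.id_apply, smul_add, Finset.smul_sum,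
      smul_comm c]

variable {φ : L →ₗ[ℂ] A} {y : σ → L} {x d : σ → A}

theorem secondOrder_apply (z : L) : secondOrder φ y d z =
    φ z + ∑ a, φ ⁅z, y a⁆ * d a + (2⁻¹ : ℂ) • ∑ a, ∑ a', φ ⁅⁅z, y a⁆, y a'⁆ * (d a * d a') := rfl

/-- `[z, y_c]` acts as the commutator of `z` with multiplication by the variable `x_c`. -/
theorem secondOrder_mul [DecidableEq σ] (hφ : ∀ z c, φ z * x c = x c * φ z)
    (hd : ∀ a c, d a * x c = x c * d a + if a = c then 1 else 0)
    (hy : ∀ a c, ⁅y a, y c⁆ = 0) (hnil : ∀ (z : L) a b c, ⁅⁅⁅z, y a⁆, y b⁆, y c⁆ = 0) (z : L) (c : σ) :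
    secondOrder φ y d z * x c = x c * secondOrder φ y d z + secondOrder φ y d ⁅z, y c⁆ := by
  -- By the Jacobi identity, since the `y a` commute. The two terms created when `d a * d a'` passes
  -- `x c` thus agree, which cancels the factor `½`.
  have hsw (a b : σ) : ⁅⁅z, y a⁆, y b⁆ = ⁅⁅z, y b⁆, y a⁆ := by
    rw [lie_lie z, hy, lie_zero, zero_sub, ← lie_skew, neg_neg]
  have h1 : (∑ a, φ ⁅z, y a⁆ * d a) * x c = x c * (∑ a, φ ⁅z, y a⁆ * d a) + φ ⁅z, y c⁆ := by
    have (a : σ) : φ ⁅z, y a⁆ * d a * x c =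
        x c * (φ ⁅z, y a⁆ * d a) + if a = c then φ ⁅z, y a⁆ else 0 := by
      rw [mul_assoc, hd, mul_add, ← mul_assoc, hφ, mul_assoc]
      split_ifs <;> simp
    rw [Finset.sum_mul, Finset.mul_sum, Finset.sum_congr rfl fun a _ => this a,
      Finset.sum_add_distrib]
    simp
  have h2 : (∑ a, ∑ a', φ ⁅⁅z, y a⁆, y a'⁆ * (d a * d a')) * x c =
      x c * (∑ a, ∑ a', φ ⁅⁅z, y a⁆, y a'⁆ * (d a * d a')) +
      (2 : ℂ) • ∑ a, φ ⁅⁅z, y c⁆, y a⁆ * d a := by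
    have (a a' : σ) : φ ⁅⁅z, y a⁆, y a'⁆ * (d a * d a') * x c =
        x c * (φ ⁅⁅z, y a⁆, y a'⁆ * (d a * d a')) +
        ((if a = c then φ ⁅⁅z, y a⁆, y a'⁆ * d a' else 0) +
         (if a' = c then φ ⁅⁅z, y a⁆, y a'⁆ * d a else 0)) := by
      rw [← mul_assoc (x c), ← hφ, mul_assoc, mul_assoc, hd, mul_add (d a), ← mul_assoc (d a), hd]
      split_ifs <;> simp [mul_add, add_mul, mul_assoc, add_assoc]
    simp only [Finset.sum_mul, Finset.mul_sum, this, Finset.sum_add_distrib]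
    congr 1
    rw [Finset.sum_comm]
    simp only [Finset.sum_ite_eq', Finset.mem_univ, if_true, two_smul]
    congr 1
    exact Finset.sum_congr rfl fun a _ => by rw [hsw]
  -- The second order part of the operator of `⁅z, y c⁆` involves only triple brackets, so it is
  -- removed by `hnil`.
  simp only [secondOrder_apply, add_mul, mul_add, smul_mul_assoc, mul_smul_comm, hφ, h1, h2,
    smul_add, hnil, map_zero, zero_mul, Finset.sum_const_zero, smul_zero, smul_smul]
  norm_num
  abel

theorem secondOrder_of_abelian {c : L} (hy : ∀ a, ⁅c, y a⁆ = 0) :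
    secondOrder φ y d c = φ c := by
  simp [secondOrder_apply, hy]

end SecondOrder

/-- A splitting `L = P ⊕ i(s)` in which `P` is abelian and `ad(P)³ = 0`. -/
structure AbelianSplitting {L s : Type*} [LieRing L] [LieAlgebra ℂ L] [LieRing s]
    [LieAlgebra ℂ s] (P : Submodule ℂ L) (i : s →ₗ⁅ℂ⁆ L) where
  /-- the projection to `P` -/
  toP : L →ₗ[ℂ] P
  /-- the projection to `s` -/
  toS : L →ₗ[ℂ] s
  decomp : ∀ x, (toP x : L) + i (toS x) = x
  toP_coe : ∀ x : P, toP x = x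
  toS_coe : ∀ x : P, toS x = 0
  toP_incl : ∀ u, toP (i u) = 0
  toS_incl : ∀ u, toS (i u) = u
  abelian : ∀ x y : P, ⁅(x : L), (y : L)⁆ = 0
  nilpotent : ∀ (z : L) (a b c : P), ⁅⁅⁅z, (a : L)⁆, (b : L)⁆, (c : L)⁆ = 0

/-! ### Checking the bracket relation on generators. -/

section Bracket

variable {L s E σ M : Type*} [LieRing L] [LieAlgebra ℂ L] [LieRing s] [LieAlgebra ℂ s]
  [AddCommGroup E] [Module ℂ E] [AddCommGroup M] [Module ℂ M] [Fintype σ]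
  {P : Submodule ℂ L} {i : s →ₗ⁅ℂ⁆ L}

/-- A linear map to operators on `M` is a representation if its commutators with `P` are right,
`M` is generated by `E` under `P`, and `E` is stable under `s`. -/
theorem map_lie_of_generators (S : AbelianSplitting P i) (b : Module.Basis σ ℂ P)
    (τ : s →ₗ⁅ℂ⁆ Module.End ℂ E) (j : E →ₗ[ℂ] M) (R : L →ₗ[ℂ] Module.End ℂ M)
    (hX : ∀ z c, R ⁅z, (b c : L)⁆ = R z * R (b c) - R (b c) * R z)
    (hj : ∀ u e, R (i u) (j e) = j (τ u e))
    (hind : ∀ p : M → Prop, (∀ e, p (j e)) → (∀ f g, p f → p g → p (f + g)) →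
      (∀ c f, p f → p (R (b c) f)) → ∀ f, p f) (z w : L) :
    R ⁅z, w⁆ = R z * R w - R w * R z := by
  have hP (z : L) (p : P) : R ⁅z, (p : L)⁆ = R z * R p - R p * R z := by
    rw [← b.sum_repr p]
    simp only [Submodule.coe_sum, Submodule.coe_smul, lie_sum, lie_smul, map_sum, map_smul, hX,
      Finset.mul_sum, Finset.sum_mul, mul_smul_comm, smul_mul_assoc, smul_sub,
      Finset.sum_sub_distrib]
  -- On the generating space, split both elements along `L = P + i(s)`: pairs involving `P` are
  -- covered by `hX`, and pairs from `s` act on `E` through the representation `τ`.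
  have hone (z w : L) (e : E) : R ⁅z, w⁆ (j e) = (R z * R w - R w * R z) (j e) := by
    have hs (u v : s) : R ⁅i u, i v⁆ (j e) =
        (R (i u) * R (i v) - R (i v) * R (i u)) (j e) := by
      rw [← LieHom.map_lie, LinearMap.sub_apply, Module.End.mul_apply, Module.End.mul_apply,
        hj, hj, hj, hj, hj, LieHom.map_lie, LieRing.of_associative_ring_bracket,
        LinearMap.sub_apply, Module.End.mul_apply, Module.End.mul_apply, map_sub]
    have hPl (p : P) (w : L) : R ⁅(p : L), w⁆ = R p * R w - R w * R p := by
      rw [← lie_skew, map_neg, hP, neg_sub]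
    have h : R ⁅z, w⁆ = R ⁅(S.toP z : L), w⁆ +
        (R ⁅i (S.toS z), (S.toP w : L)⁆ + R ⁅i (S.toS z), i (S.toS w)⁆) := by
      rw [← map_add, ← lie_add, S.decomp, ← map_add, ← add_lie, S.decomp]
    rw [h, hPl, hP, LinearMap.add_apply, LinearMap.add_apply, hs, ← LinearMap.add_apply,
      ← LinearMap.add_apply]
    have hz : R z = R (S.toP z) + R (i (S.toS z)) := by rw [← map_add, S.decomp]
    have hw : R w = R (S.toP w) + R (i (S.toS w)) := by rw [← map_add, S.decomp]
    rw [hz, hw]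
    simp only [add_mul, mul_add]
    congr 1
    abel
  refine LinearMap.ext fun f => ?_
  revert z w
  refine hind (fun f => ∀ z w, R ⁅z, w⁆ f = (R z * R w - R w * R z) f) ?_ ?_ ?_ f
  · exact fun e z w => hone z w e
  · exact fun f g hf hg z w => by rw [map_add, map_add, hf, hg]
  -- Moving `b c` to the left and using the Jacobi identity reduces the relation at `R (b c) f` to
  -- relations at `f` for `(z, w)`, `(z, ⁅w, b c⁆)` and `(w, ⁅z, b c⁆)`; hence the quantification
  -- over all pairs.
  · intro c f hf z w
    have e1 (z : L) (g : M) : R z (R (b c) g) = R (b c) (R z g) + R ⁅z, (b c : L)⁆ g := by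
      rw [hX, LinearMap.sub_apply, Module.End.mul_apply, Module.End.mul_apply]
      abel
    have hJ : ⁅⁅z, w⁆, (b c : L)⁆ = ⁅z, ⁅w, (b c : L)⁆⁆ - ⁅w, ⁅z, (b c : L)⁆⁆ := lie_lie _ _ _
    simp only [LinearMap.sub_apply, Module.End.mul_apply] at hf ⊢
    rw [e1 ⁅z, w⁆, hf z w, hJ, map_sub R, LinearMap.sub_apply, hf z, hf w ⁅z, _⁆, e1 w f, e1 z f,
      map_add, map_add, e1 z (R w f), e1 w (R z f), map_sub (R (b c))]
    abel

end Bracket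

/-! ### The induced module modelled on `E`-valued polynomials. -/

section Model

variable (σ E : Type*) [AddCommGroup E] [Module ℂ E]

/-- `E`-valued polynomials. -/
def PolyE : Type _ := MvPolynomial σ ℂ ⊗[ℂ] E

instance : AddCommGroup (PolyE σ E) := inferInstanceAs (AddCommGroup (MvPolynomial σ ℂ ⊗[ℂ] E))

instance : Module ℂ (PolyE σ E) := inferInstanceAs (Module ℂ (MvPolynomial σ ℂ ⊗[ℂ] E))

variable {σ E}

namespace PolyE

/-- The polynomial `g ⊗ e`. -/
def tmul : MvPolynomial σ ℂ →ₗ[ℂ] E →ₗ[ℂ] PolyE σ E := TensorProduct.mk ℂ (MvPolynomial σ ℂ) E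

variable (E) in
/-- Operators on polynomials act on `E`-valued polynomials. -/
def left : Module.End ℂ (MvPolynomial σ ℂ) →ₗ[ℂ] Module.End ℂ (PolyE σ E) :=
  LinearMap.rTensorHom E

variable (σ) in
/-- Operators on `E` act on `E`-valued polynomials. -/
def right : Module.End ℂ E →ₗ[ℂ] Module.End ℂ (PolyE σ E) :=
  LinearMap.lTensorHom (MvPolynomial σ ℂ)

theorem left_tmul (T : Module.End ℂ (MvPolynomial σ ℂ)) (g : MvPolynomial σ ℂ) (e : E) :
    left E T (tmul g e) = tmul (T g) e := rfl

theorem right_tmul (T : Module.End ℂ E) (g : MvPolynomial σ ℂ) (e : E) :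
    right σ T (tmul g e) = tmul g (T e) := rfl

theorem hom_ext {N : Type*} [AddCommGroup N] [Module ℂ N] {T T' : PolyE σ E →ₗ[ℂ] N}
    (h : ∀ g e, T (tmul g e) = T' (tmul g e)) : T = T' := TensorProduct.ext' h

variable (E) in
/-- Multiplication by a polynomial. -/
def mul : MvPolynomial σ ℂ →ₗ[ℂ] Module.End ℂ (PolyE σ E) :=
  left E ∘ₗ LinearMap.mul ℂ (MvPolynomial σ ℂ)

variable (E) in
/-- Partial derivatives. -/
def deriv (a : σ) : Module.End ℂ (PolyE σ E) := left E (MvPolynomial.pderiv a).toLinearMap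

theorem mul_tmul (f g : MvPolynomial σ ℂ) (e : E) : mul E f (tmul g e) = tmul (f * g) e := rfl

theorem deriv_tmul (a : σ) (g : MvPolynomial σ ℂ) (e : E) :
    deriv E a (tmul g e) = tmul (MvPolynomial.pderiv a g) e := rfl

theorem deriv_mul_X [DecidableEq σ] (a c : σ) :
    deriv E a * mul E (MvPolynomial.X c) =
      mul E (MvPolynomial.X c) * deriv E a + if a = c then 1 else 0 := by
  refine hom_ext fun g e => ?_
  rw [LinearMap.add_apply, Module.End.mul_apply, Module.End.mul_apply, mul_tmul,
    deriv_tmul, deriv_tmul, mul_tmul, Derivation.leibniz, MvPolynomial.pderiv_X, map_add,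
    LinearMap.add_apply]
  congr 1
  rcases eq_or_ne a c with rfl | h
  · simp
  · simp [h, Ne.symm h]

theorem induction {p : PolyE σ E → Prop} (one : ∀ e, p (tmul 1 e))
    (add : ∀ f g, p f → p g → p (f + g)) (X : ∀ c f, p f → p (mul E (MvPolynomial.X c) f))
    (f : PolyE σ E) : p f := by
  refine TensorProduct.induction_on (motive := p) f ?_ ?_ add
  · have := one 0
    rwa [map_zero] at this
  · intro g e
    change p (tmul g e)
    induction g using MvPolynomial.induction_on generalizing e with
    | C c =>
      have := one (c • e)
      rwa [map_smul, ← LinearMap.smul_apply, ← map_smul, ← MvPolynomial.C_eq_smul_one] at this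
    | add f g hf hg =>
      rw [map_add]
      exact add _ _ (hf e) (hg e)
    | mul_X f c hf =>
      have := X c _ (hf e)
      rwa [mul_tmul, mul_comm] at this

end PolyE

variable {L s : Type*} [LieRing L] [LieAlgebra ℂ L] [LieRing s] [LieAlgebra ℂ s]
  {P : Submodule ℂ L} {i : s →ₗ⁅ℂ⁆ L}
  (S : AbelianSplitting P i) (b : Module.Basis σ ℂ P) (τ : s →ₗ⁅ℂ⁆ Module.End ℂ E)

namespace AbelianSplitting

/-- The order zero part of the action on polynomials: elements of `P` act by multiplication,
elements of `s` act on `E`. -/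
def order0 : L →ₗ[ℂ] Module.End ℂ (PolyE σ E) :=
  PolyE.mul E ∘ₗ b.constr ℂ MvPolynomial.X ∘ₗ S.toP +
    PolyE.right σ ∘ₗ (τ : s →ₗ[ℂ] Module.End ℂ E) ∘ₗ S.toS

theorem order0_apply (z : L) : S.order0 b τ z =
    PolyE.mul E (b.constr ℂ MvPolynomial.X (S.toP z)) + PolyE.right σ (τ (S.toS z)) := rfl

theorem order0_commute (z : L) (c : σ) :
    S.order0 b τ z * PolyE.mul E (MvPolynomial.X c) =
      PolyE.mul E (MvPolynomial.X c) * S.order0 b τ z := by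
  refine PolyE.hom_ext fun g e => ?_
  simp only [order0_apply, Module.End.mul_apply, LinearMap.add_apply, PolyE.mul_tmul,
    PolyE.right_tmul, map_add, mul_left_comm]

theorem order0_incl (u : s) (e : E) :
    S.order0 b τ (i u) (PolyE.tmul 1 e) = PolyE.tmul 1 (τ u e) := by
  rw [order0_apply, S.toP_incl, S.toS_incl, map_zero, map_zero, zero_add, PolyE.right_tmul]

theorem order0_coe (p : P) : S.order0 b τ p = PolyE.mul E (b.constr ℂ MvPolynomial.X p) := by
  rw [order0_apply, S.toP_coe, S.toS_coe, map_zero, map_zero, add_zero]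

variable [Fintype σ]

/-- The operator of an element of `L` on `E`-valued polynomials. -/
def polyAct : L →ₗ[ℂ] Module.End ℂ (PolyE σ E) :=
  secondOrder (S.order0 b τ) (fun a => (b a : L)) (PolyE.deriv E)

/-- Derivatives kill constants, so only the order zero part survives. -/
theorem polyAct_one (z : L) (e : E) :
    S.polyAct b τ z (PolyE.tmul 1 e) = S.order0 b τ z (PolyE.tmul 1 e) := by
  have h (a : σ) : PolyE.deriv E a (PolyE.tmul 1 e) = 0 := by
    rw [PolyE.deriv_tmul, MvPolynomial.pderiv_one, map_zero, LinearMap.zero_apply]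
  simp [polyAct, secondOrder_apply, LinearMap.sum_apply, h]

theorem polyAct_coe (p : P) :
    S.polyAct b τ p = PolyE.mul E (b.constr ℂ MvPolynomial.X p) := by
  rw [polyAct, secondOrder_of_abelian fun a => S.abelian p (b a), order0_coe]

theorem polyAct_basis (c : σ) : S.polyAct b τ (b c) = PolyE.mul E (MvPolynomial.X c) := by
  rw [polyAct_coe, b.constr_basis]

/-- Only commutators with the variables need computing, by `secondOrder_mul`; the other brackets
follow because constants and multiplication by variables generate `ℂ[x] ⊗ E`. -/
theorem polyAct_lie (z w : L) : S.polyAct b τ ⁅z, w⁆ =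
    S.polyAct b τ z * S.polyAct b τ w - S.polyAct b τ w * S.polyAct b τ z := by
  classical
  refine map_lie_of_generators S b τ (PolyE.tmul 1) (S.polyAct b τ) ?_ ?_ ?_ z w
  · intro z c
    rw [polyAct_basis, polyAct, secondOrder_mul (S.order0_commute b τ) PolyE.deriv_mul_X
      (fun a c => S.abelian _ _) (fun z a b c => S.nilpotent _ _ _ _)]
    abel
  · exact fun u e => by rw [polyAct_one, order0_incl]
  · exact fun p h1 h2 h3 f => PolyE.induction h1 h2
      (fun c f hf => by rw [← S.polyAct_basis b τ]; exact h3 c f hf) f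

/-- The `L`-module structure on `E`-valued polynomials. -/
def polyRep : L →ₗ⁅ℂ⁆ Module.End ℂ (PolyE σ E) :=
  { S.polyAct b τ with map_lie' := fun {z w} => S.polyAct_lie b τ z w }

theorem polyRep_apply (z : L) : S.polyRep b τ z = S.polyAct b τ z := rfl

/-- The constants form a copy of the `U(s)`-module `E`, as Frobenius reciprocity requires. -/
theorem uRep_polyRep_incl (v : U s) (e : E) :
    uRep (S.polyRep b τ) (uMap i v) (PolyE.tmul 1 e) = PolyE.tmul 1 (uRep τ v e) := by
  induction v using U_induction generalizing e with
  | algebraMap c => simp [Algebra.algebraMap_eq_smul_one]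
  | ι x => rw [uMap_ι, uRep_ι, uRep_ι, polyRep_apply, polyAct_one, order0_incl]
  | mul a b ha hb =>
    rw [map_mul, map_mul, Module.End.mul_apply, hb, ha, map_mul, Module.End.mul_apply]
  | add a b ha hb => simp only [map_add, LinearMap.add_apply, ha, hb]

/-- There is a map `U(L) ⊗_{U(s)} E → ℂ[x] ⊗ E`, `a ⊗ e ↦ a (1 ⊗ e)`. -/
theorem exists_toPoly (S : AbelianSplitting P i) (b : Module.Basis σ ℂ P)
    (τ : s →ₗ⁅ℂ⁆ Module.End ℂ E) : ∃ Ψ : LieInd i τ →ₗ[ℂ] PolyE σ E,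
    (∀ e, Ψ (Ind.mk (uMap i) (uRep τ) 1 e) = PolyE.tmul 1 e) ∧
    ∀ (p : P) (v : LieInd i τ),
      Ψ (act i τ p v) = PolyE.mul E (b.constr ℂ MvPolynomial.X p) (Ψ v) := by
  let _ : Module (U L) (PolyE σ E) := Module.compHom _ (uRep (S.polyRep b τ)).toRingHom
  have _ : IsScalarTower ℂ (U L) (PolyE σ E) := ⟨fun c a v => by
    change uRep (S.polyRep b τ) (c • a) v = c • uRep (S.polyRep b τ) a v
    rw [map_smul, LinearMap.smul_apply]⟩
  have hg (v : U s) (e : E) : PolyE.tmul (σ := σ) 1 (uRep τ v e) = uMap i v • PolyE.tmul 1 e :=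
    (S.uRep_polyRep_incl b τ v e).symm
  let Ψ : LieInd i τ →ₗ[U L] PolyE σ E := Ind.lift (PolyE.tmul 1) hg
  refine ⟨Ψ.restrictScalars ℂ,
    fun e => (Ind.lift_mk (PolyE.tmul 1) hg 1 e).trans (one_smul (U L) _), fun p v => ?_⟩
  refine (Ψ.map_smul _ _).trans ?_
  change uRep (S.polyRep b τ) (UniversalEnvelopingAlgebra.ι ℂ (p : L)) (Ψ v) = _
  rw [uRep_ι, polyRep_apply, polyAct_coe]
  rfl

end AbelianSplitting

end Model


/-! ### Degree in the polynomial model. -/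

theorem homogeneousComponent_X_mul {σ : Type*} (c : σ) (f : MvPolynomial σ ℂ) (n : ℕ) :
    MvPolynomial.homogeneousComponent (n + 1) (MvPolynomial.X c * f) =
      MvPolynomial.X c * MvPolynomial.homogeneousComponent n f := by
  classical
  ext d
  rw [MvPolynomial.coeff_homogeneousComponent, MvPolynomial.coeff_X_mul',
    MvPolynomial.coeff_X_mul', MvPolynomial.coeff_homogeneousComponent]
  by_cases hc : c ∈ d.support
  · simp only [hc, if_true]
    have : d.degree = (d - Finsupp.single c 1).degree + 1 := by
      have h : d - Finsupp.single c 1 + Finsupp.single c 1 = d :=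
        tsub_add_cancel_of_le (Finsupp.single_le_iff.2
          (Nat.one_le_iff_ne_zero.2 (Finsupp.mem_support_iff.1 hc)))
      conv_lhs => rw [← h]
      rw [map_add, Finsupp.degree_single]
    simp only [this, Nat.add_right_cancel_iff]
  · simp [hc]

namespace PolyE

variable {σ E : Type*} [AddCommGroup E] [Module ℂ E]

theorem mul_mul (f g : MvPolynomial σ ℂ) : mul E (f * g) = mul E f * mul E g :=
  hom_ext fun h e => by
    rw [Module.End.mul_apply, mul_tmul, mul_tmul, mul_tmul, mul_assoc]

/-- The homogeneous component of degree `n`. -/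
def component (n : ℕ) : Module.End ℂ (PolyE σ E) :=
  left E (MvPolynomial.homogeneousComponent n)

/-- The multiplier is a linear form, hence homogeneous of degree one. -/
theorem component_mul {L : Type*} [AddCommGroup L] [Module ℂ L] (b : Module.Basis σ ℂ L) (p : L)
    (n : ℕ) (f : PolyE σ E) :
    component (n + 1) (mul E (b.constr ℂ MvPolynomial.X p) f) =
      mul E (b.constr ℂ MvPolynomial.X p) (component n f) := by
  have : component (n + 1) ∘ₗ mul E (b.constr ℂ MvPolynomial.X p) =
      mul E (b.constr ℂ MvPolynomial.X p) ∘ₗ component n := by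
    refine hom_ext fun g e => ?_
    simp only [LinearMap.comp_apply, component, mul_tmul, left_tmul]
    congr 2
    rw [b.constr_apply, Finsupp.sum, Finset.sum_mul, Finset.sum_mul, map_sum]
    exact Finset.sum_congr rfl fun c _ => by
      rw [smul_mul_assoc, map_smul, homogeneousComponent_X_mul, smul_mul_assoc]
  exact congrArg (fun T => T f) this

theorem component_zero_one (e : E) : component 0 (tmul (σ := σ) 1 e) = tmul 1 e := by
  rw [component, left_tmul, MvPolynomial.homogeneousComponent_zero, MvPolynomial.coeff_zero_one,
    map_one]

theorem component_one_of_pos {n : ℕ} (hn : 0 < n) (e : E) :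
    component n (tmul (σ := σ) 1 e) = 0 := by
  rw [component, left_tmul, MvPolynomial.homogeneousComponent_eq_zero _ _
    (by rwa [MvPolynomial.totalDegree_one]), map_zero, LinearMap.zero_apply]

end PolyE

/-! ### Injectivity of `S(P) ⊗ E → Gr` by leading terms. -/

section Injectivity

variable {L s E σ : Type*} [LieRing L] [LieAlgebra ℂ L]
  [LieRing s] [LieAlgebra ℂ s] [AddCommGroup E] [Module ℂ E]
  {P : Submodule ℂ L} {i : s →ₗ⁅ℂ⁆ L} {τ : s →ₗ⁅ℂ⁆ Module.End ℂ E}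

/-- A map to polynomials which is compatible with multiplication by `P` makes the natural map
from `S(P) ⊗ E` to the associated graded space injective. -/
theorem symToGr_injective_of_toPoly (hP : BracketCondition P i) (b : Module.Basis σ ℂ P)
    (Ψ : LieInd i τ →ₗ[ℂ] PolyE σ E)
    (h1 : ∀ e, Ψ (Ind.mk (uMap i) (uRep τ) 1 e) = PolyE.tmul 1 e)
    (hmul : ∀ (p : P) (v : LieInd i τ),
      Ψ (act i τ p v) = PolyE.mul E (b.constr ℂ MvPolynomial.X p) (Ψ v)) :
    Function.Injective (symToGr hP τ) := by
  -- `Ψ` takes products of `r` elements of `P` to polynomials of degree at most `r`.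
  have hlist (l : List P) (e : E) : ∀ k, l.length < k → PolyE.component k (Ψ (Ind.mk (uMap i)
      (uRep τ) (l.map fun x => UniversalEnvelopingAlgebra.ι ℂ (x : L)).prod e)) = 0 := by
    induction l with
    | nil =>
      intro k hk
      exact (congrArg _ (h1 e)).trans (PolyE.component_one_of_pos hk e)
    | cons x l ih =>
      intro k hk
      obtain ⟨k, rfl⟩ : ∃ j, k = j + 1 := ⟨k - 1, by simp at hk; omega⟩
      rw [prod_map_ι_cons, ← act_mk, hmul, PolyE.component_mul, ih k (by simpa using hk), map_zero]
  have hprev (n : ℕ) : prev (filt P i τ) n ≤ LinearMap.ker (PolyE.component n ∘ₗ Ψ) := by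
    cases n with
    | zero => exact bot_le
    | succ n =>
      refine Submodule.span_le.2 ?_
      rintro _ ⟨l, e, hl, rfl⟩
      exact hlist l e _ (Nat.lt_succ_of_le hl)
  -- The leading term map: in degree `n` it takes the degree `n` part of `Ψ`, which is well defined
  -- by `hprev`.
  let H : Gr (filt P i τ) →ₗ[ℂ] PolyE σ E := DirectSum.toModule ℂ ℕ _ fun n =>
    ((prev (filt P i τ) n).submoduleOf (filt P i τ n)).liftQ
      ((PolyE.component n ∘ₗ Ψ) ∘ₗ (filt P i τ n).subtype) fun v hv => hprev n hv
  have hH (n : ℕ) (v : filt P i τ n) : H (symbol _ n v) = PolyE.component n (Ψ v) := by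
    simp only [H, symbol, LinearMap.comp_apply, DirectSum.toModule_lof]
    rfl
  have hgr (a : SymmetricAlgebra ℂ P) : ∀ y, H (grSym hP τ a y) =
      PolyE.mul E (SymmetricAlgebra.equivMvPolynomial b a) (H y) := by
    induction a using SymmetricAlgebra.induction with
    | algebraMap c =>
      intro y
      have : PolyE.mul E (algebraMap ℂ (MvPolynomial σ ℂ) c) = c • 1 := by
        refine PolyE.hom_ext fun g e => ?_
        rw [PolyE.mul_tmul, ← Algebra.smul_def, map_smul]
        rfl
      rw [AlgHom.commutes, AlgEquiv.commutes, this, Module.algebraMap_end_apply, map_smul]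
      rfl
    | ι p =>
      intro y
      have hp : SymmetricAlgebra.equivMvPolynomial b (SymmetricAlgebra.ι ℂ P p) =
          b.constr ℂ MvPolynomial.X p := SymmetricAlgebra.lift_ι_apply _ _
      have : H ∘ₗ grAct P i τ p = PolyE.mul E (b.constr ℂ MvPolynomial.X p) ∘ₗ H := by
        refine gr_hom_ext fun n v => ?_
        rw [LinearMap.comp_apply, LinearMap.comp_apply, grAct_symbol, hH, hH, hmul,
          PolyE.component_mul]
      rw [hp, grSym, symLift_ι]
      exact congrArg (fun T => T y) this
    | mul a a' ha ha' =>
      intro y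
      rw [map_mul, map_mul, Module.End.mul_apply, ha, ha', PolyE.mul_mul, Module.End.mul_apply]
    | add a a' ha ha' =>
      intro y
      rw [map_add, map_add, LinearMap.add_apply, map_add, ha, ha', map_add, LinearMap.add_apply]
  -- The composite is the isomorphism `S(P) ⊗ E ≅ ℂ[x] ⊗ E` given by the basis, so its first factor
  -- is injective.
  have hcomp : H ∘ₗ symToGr hP τ =
      (LinearEquiv.rTensor E (SymmetricAlgebra.equivMvPolynomial b).toLinearEquiv).toLinearMap := by
    refine TensorProduct.ext' fun a e => ?_
    rw [LinearMap.comp_apply, symToGr_tmul, hgr, grOne, LinearMap.comp_apply, hH]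
    change PolyE.mul E _ (PolyE.component 0 (Ψ (Ind.mk (uMap i) (uRep τ) 1 e))) = _
    rw [h1, PolyE.component_zero_one, PolyE.mul_tmul, mul_one]
    rfl
  refine Function.Injective.of_comp (f := H) ?_
  rw [← LinearMap.coe_comp, hcomp]
  exact LinearEquiv.injective _

theorem symToGr_injective [Finite σ] (S : AbelianSplitting P i) (hP : BracketCondition P i)
    (b : Module.Basis σ ℂ P) (τ : s →ₗ⁅ℂ⁆ Module.End ℂ E) :
    Function.Injective (symToGr hP τ) := by
  have := Fintype.ofFinite σ
  obtain ⟨Ψ, h1, h2⟩ := S.exists_toPoly b τ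
  exact symToGr_injective_of_toPoly hP b Ψ h1 h2

end Injectivity

/-! ### Functoriality of symmetric algebras and graded modules. -/

section SymMap

variable {M N : Type*} [AddCommGroup M] [Module ℂ M] [AddCommGroup N] [Module ℂ N]

theorem symMap_ι (φ : M →ₗ[ℂ] N) (x : M) :
    symMap φ (SymmetricAlgebra.ι ℂ M x) = SymmetricAlgebra.ι ℂ N (φ x) :=
  SymmetricAlgebra.lift_ι_apply _ _

/-- A linear equivalence induces an equivalence of symmetric algebras. -/
def symEquiv (φ : M ≃ₗ[ℂ] N) : SymmetricAlgebra ℂ M ≃ₐ[ℂ] SymmetricAlgebra ℂ N :=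
  AlgEquiv.ofAlgHom (symMap φ.toLinearMap) (symMap φ.symm.toLinearMap)
    (SymmetricAlgebra.algHom_ext (LinearMap.ext fun x => by
      change symMap _ (symMap _ (SymmetricAlgebra.ι ℂ N x)) = SymmetricAlgebra.ι ℂ N x
      rw [symMap_ι, symMap_ι]
      exact congrArg _ (φ.apply_symm_apply x)))
    (SymmetricAlgebra.algHom_ext (LinearMap.ext fun x => by
      change symMap _ (symMap _ (SymmetricAlgebra.ι ℂ M x)) = SymmetricAlgebra.ι ℂ M x
      rw [symMap_ι, symMap_ι]
      exact congrArg _ (φ.symm_apply_apply x)))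

end SymMap

section Functoriality

variable {L L' s s' E : Type*} [LieRing L] [LieAlgebra ℂ L] [LieRing L'] [LieAlgebra ℂ L']
  [LieRing s] [LieAlgebra ℂ s] [LieRing s'] [LieAlgebra ℂ s'] [AddCommGroup E] [Module ℂ E]
  {P : Submodule ℂ L} {P' : Submodule ℂ L'} {i : s →ₗ⁅ℂ⁆ L} {i' : s' →ₗ⁅ℂ⁆ L'}
  {τ : s →ₗ⁅ℂ⁆ Module.End ℂ E} {τ' : s' →ₗ⁅ℂ⁆ Module.End ℂ E}
  {T : LieInd i τ →ₗ[ℂ] LieInd i' τ'} {hT : ∀ k, filt P i τ k ≤ (filt P' i' τ' k).comap T}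
  {φ : P →ₗ[ℂ] P'}

/-- By `hφ`, the discrepancy between `T ∘ x` and `φ(x) ∘ T` does not raise the degree, so it
vanishes in the graded piece of degree `k + 1`. -/
theorem grMap_grAct
    (hφ : ∀ (x : P) k, ∀ v ∈ filt P i τ k, T (act i τ x v) - act i' τ' (φ x) (T v) ∈
      filt P' i' τ' k) (x : P) (y : Gr (filt P i τ)) :
    grMap T hT (grAct P i τ x y) = grAct P' i' τ' (φ x) (grMap T hT y) := by
  have : grMap T hT ∘ₗ grAct P i τ x = grAct P' i' τ' (φ x) ∘ₗ grMap T hT := by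
    refine gr_hom_ext fun k v => ?_
    rw [LinearMap.comp_apply, LinearMap.comp_apply, grAct_symbol, grMap_symbol, grMap_symbol,
      grAct_symbol]
    exact symbol_eq_of_sub_mem (hφ x k v v.2)
  exact congrArg (fun T => T y) this

theorem grMap_grSym (hP : BracketCondition P i) (hP' : BracketCondition P' i')
    (hφ : ∀ (x : P) k, ∀ v ∈ filt P i τ k, T (act i τ x v) - act i' τ' (φ x) (T v) ∈
      filt P' i' τ' k) (a : SymmetricAlgebra ℂ P) (y : Gr (filt P i τ)) :
    grMap T hT (grSym hP τ a y) = grSym hP' τ' (symMap φ a) (grMap T hT y) := by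
  induction a using SymmetricAlgebra.induction generalizing y with
  | algebraMap c =>
    rw [AlgHom.commutes, AlgHom.commutes, AlgHom.commutes, Module.algebraMap_end_apply,
      Module.algebraMap_end_apply, map_smul]
  | ι x => rw [symMap_ι, grSym, grSym, symLift_ι, symLift_ι, grMap_grAct hφ]
  | mul a b ha hb =>
    rw [map_mul, map_mul, map_mul, Module.End.mul_apply, Module.End.mul_apply, ha, hb]
  | add a b ha hb =>
    rw [map_add, map_add, map_add, LinearMap.add_apply, LinearMap.add_apply, map_add, ha, hb]

theorem grMap_symToGr (hP : BracketCondition P i) (hP' : BracketCondition P' i')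
    (hφ : ∀ (x : P) k, ∀ v ∈ filt P i τ k, T (act i τ x v) - act i' τ' (φ x) (T v) ∈
      filt P' i' τ' k)
    (hone : ∀ e, T (Ind.mk (uMap i) (uRep τ) 1 e) = Ind.mk (uMap i') (uRep τ') 1 e)
    (a : SymmetricAlgebra ℂ P) (e : E) :
    grMap T hT (symToGr hP τ (a ⊗ₜ[ℂ] e)) = symToGr hP' τ' (symMap φ a ⊗ₜ[ℂ] e) := by
  rw [symToGr_tmul, grMap_grSym hP hP' hφ, symToGr_tmul]
  congr 1
  rw [grOne, LinearMap.comp_apply, grMap_symbol]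
  exact congrArg (symbol _ 0) (Subtype.ext (hone e))

end Functoriality


/-! ### Decompositions of the matrix Lie algebras. -/

open Matrix

section Splittings

variable {m n : ℕ}

/-- `gl_{m+n} = 𝔭⁺ ⊕ 𝔮'`. -/
def splittingPPlus (m n : ℕ) : AbelianSplitting (pPlus m n) (qPrime m n).incl where
  toP :=
    { toFun := fun Z => ⟨fromBlocks 0 Z.toBlocks₁₂ 0 0, _, rfl⟩
      map_add' := fun Z Z' => by
        ext1
        ext (i | i) (j | j) <;> simp [toBlocks₁₂]
      map_smul' := fun c Z => by
        ext1
        ext (i | i) (j | j) <;> simp [toBlocks₁₂] }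
  toS :=
    { toFun := fun Z => ⟨fromBlocks Z.toBlocks₁₁ 0 Z.toBlocks₂₁ Z.toBlocks₂₂, _, _, _, rfl⟩
      map_add' := fun Z Z' => by
        ext1
        ext (i | i) (j | j) <;> simp [toBlocks₁₁, toBlocks₂₁, toBlocks₂₂]
      map_smul' := fun c Z => by
        ext1
        ext (i | i) (j | j) <;> simp [toBlocks₁₁, toBlocks₂₁, toBlocks₂₂] }
  decomp Z := by
    ext (i | i) (j | j) <;> simp [toBlocks₁₁, toBlocks₁₂, toBlocks₂₁, toBlocks₂₂]
  toP_coe := by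
    rintro ⟨_, A, rfl⟩
    rfl
  toS_coe := by
    rintro ⟨_, A, rfl⟩
    ext1
    ext (i | i) (j | j) <;> simp
  toP_incl := by
    rintro ⟨_, X, B, Y, rfl⟩
    ext1
    ext (i | i) (j | j) <;> simp
  toS_incl := by
    rintro ⟨_, X, B, Y, rfl⟩
    rfl
  abelian := by
    rintro ⟨_, A, rfl⟩ ⟨_, B, rfl⟩
    simp [LieRing.of_associative_ring_bracket, fromBlocks_multiply]
  -- Bracketing with `𝔭⁺` sends `𝔭⁻` to `𝔨'`, `𝔨'` to `𝔭⁺`, and `𝔭⁺` to zero.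
  nilpotent := by
    rintro Z ⟨_, A, rfl⟩ ⟨_, B, rfl⟩ ⟨_, C, rfl⟩
    rw [← fromBlocks_toBlocks Z]
    simp [LieRing.of_associative_ring_bracket, fromBlocks_multiply, fromBlocks_sub']

theorem hAlg_decomp (x : hAlg m n) : ∃ p ∈ pAlg m n, ∃ u : kAlg m n,
    x = p + LieSubalgebra.inclusion (inf_le_right : kAlg m n ≤ hAlg m n) u := by
  obtain ⟨Z, hZ⟩ := x
  obtain ⟨X, A, B, Y, rfl⟩ : ∃ X A B Y, Z = fromBlocks X A B Y :=
    ⟨_, _, _, _, (fromBlocks_toBlocks Z).symm⟩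
  obtain ⟨hX, rfl, hY⟩ := (mem_hAlg_iff _ _ _ _).1 hZ
  refine ⟨⟨fromBlocks 0 A Aᵀ 0, (mem_hAlg_iff _ _ _ _).2 ⟨by simp, rfl, by simp⟩⟩, ⟨A, rfl⟩,
    ⟨fromBlocks X 0 0 Y, ⟨X, Y, rfl⟩, (mem_hAlg_iff _ _ _ _).2 ⟨hX, by simp, hY⟩⟩, ?_⟩
  ext1
  change fromBlocks X A Aᵀ Y = fromBlocks 0 A Aᵀ 0 + fromBlocks X 0 0 Y
  simp [fromBlocks_add]

theorem gPrime_decomp (x : gPrime m n) : ∃ p ∈ pPlus m n, ∃ u : qPrime m n,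
    x = p + (qPrime m n).incl u :=
  ⟨_, ((splittingPPlus m n).toP x).2, _, ((splittingPPlus m n).decomp x).symm⟩

/-- An element of `𝔭` differs from its image under `φ` by an element of `𝔭⁻ ⊆ 𝔮'`. -/
theorem pEquiv_decomp (x : pAlg m n) :
    ∃ u : qPrime m n, ((x : hAlg m n) : gPrime m n) = pEquiv m n x + (qPrime m n).incl u := by
  obtain ⟨⟨Z, h⟩, A, hA⟩ := x
  obtain rfl : Z = fromBlocks 0 A Aᵀ 0 := hA
  refine ⟨⟨fromBlocks 0 0 Aᵀ 0, 0, Aᵀ, 0, rfl⟩, ?_⟩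
  change fromBlocks 0 A Aᵀ 0 = fromBlocks 0 A 0 0 + fromBlocks 0 0 Aᵀ 0
  simp [fromBlocks_add]

end Splittings

/-! ### The map `T` and its associated graded map. -/

variable (m n : ℕ) (E : Type*) [AddCommGroup E] [Module ℂ E]
  [LieRingModule (kPrime m n) E] [LieModule ℂ (kPrime m n) E]

theorem mapT_act (x : hAlg m n) (v : VE m n E) :
    mapT m n E (act _ _ x v) = act _ _ (x : gPrime m n) (mapT m n E v) := by
  rw [act_apply, (mapT m n E).map_smul, VPlus_smul_def, uMap_ι, act_apply]
  rfl

theorem mapT_mk_one (e : E) : mapT m n E (Ind.mk _ _ 1 e) = Ind.mk _ _ 1 e := by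
  rw [mapT_mk, map_one]

/-- Elements of `𝔭` do not lie in `𝔭⁺` in general, but every element of `𝔤'` raises the degree in
`V_E⁺` by at most one. -/
theorem filtV_le_comap (k : ℕ) :
    filtV m n E k ≤ (filtVPlus m n E k).comap ((mapT m n E).restrictScalars ℂ) := by
  refine Submodule.span_le.2 ?_
  rintro _ ⟨l, e, hl, rfl⟩
  induction l generalizing k with
  | nil =>
    change mapT m n E (Ind.mk _ _ 1 e) ∈ filtVPlus m n E k
    rw [mapT_mk_one]
    exact mk_mem_filt (P := pPlus m n) [] e (Nat.zero_le k)
  | cons x l ih =>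
    obtain ⟨k, rfl⟩ : ∃ j, k = j + 1 := ⟨k - 1, by simp at hl; omega⟩
    rw [prod_map_ι_cons, ← act_mk]
    change mapT m n E (act _ _ _ _) ∈ filtVPlus m n E (k + 1)
    rw [mapT_act]
    exact act_mem_filt_succ gPrime_decomp _ (ih k (by simpa using hl))

/-- The map `T_G`. -/
abbrev mapTG : Gr (filtV m n E) →ₗ[ℂ] Gr (filtVPlus m n E) :=
  grMap ((mapT m n E).restrictScalars ℂ) (filtV_le_comap m n E)

/-- The difference is the action of `x - φ(x) ∈ 𝔮'` on `T v`, and `𝔮'` preserves the filtration of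
`V_E⁺`. -/
theorem mapT_act_sub_mem (x : pAlg m n) (k : ℕ) (v : VE m n E) (hv : v ∈ filtV m n E k) :
    (mapT m n E).restrictScalars ℂ (act _ _ (x : hAlg m n) v) -
      act _ _ ((pEquiv m n).toLinearMap x : gPrime m n) ((mapT m n E).restrictScalars ℂ v) ∈
        filtVPlus m n E k := by
  obtain ⟨u, hu⟩ := pEquiv_decomp x
  change mapT m n E (act _ _ (x : hAlg m n) v) -
    act _ _ (pEquiv m n x : gPrime m n) (mapT m n E v) ∈ filtVPlus m n E k
  rw [mapT_act, hu, map_add, LinearMap.add_apply, add_sub_cancel_left]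
  exact filt_le_comap_act_of_decomp gPrime_decomp u k (filtV_le_comap m n E k hv)

theorem mapTG_symActV (a : SymmetricAlgebra ℂ (pAlg m n)) (y : Gr (filtV m n E)) :
    mapTG m n E (symActV m n E a y) =
      symActVPlus m n E (symMap (pEquiv m n).toLinearMap a) (mapTG m n E y) :=
  grMap_grSym _ _ (mapT_act_sub_mem m n E) a y

theorem mapTG_symToGrV (a : SymmetricAlgebra ℂ (pAlg m n)) (e : E) :
    mapTG m n E (symToGrV m n E (a ⊗ₜ[ℂ] e)) =
      symToGrVPlus m n E (symMap (pEquiv m n).toLinearMap a ⊗ₜ[ℂ] e) :=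
  grMap_symToGr _ _ (mapT_act_sub_mem m n E) (mapT_mk_one m n E) a e

theorem symToGrVPlus_bijective : Function.Bijective (symToGrVPlus m n E) :=
  ⟨symToGr_injective (splittingPPlus m n) _ (Module.finBasis ℂ (pPlus m n)) _,
    symToGr_surjective _ _⟩

theorem mapTG_comp_symToGrV_bijective :
    Function.Bijective (mapTG m n E ∘ symToGrV m n E) := by
  have : mapTG m n E ∘ₗ symToGrV m n E = symToGrVPlus m n E ∘ₗ
      (LinearEquiv.rTensor E (symEquiv (pEquiv m n)).toLinearEquiv).toLinearMap :=
    TensorProduct.ext' fun a e => mapTG_symToGrV m n E a e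
  rw [← LinearMap.coe_comp, this, LinearMap.coe_comp]
  exact (symToGrVPlus_bijective m n E).comp (LinearEquiv.bijective _)

/-- Injectivity is inherited from the composite with `T_G`, so no polynomial model of `V_E` itself
is needed. -/
theorem symToGrV_bijective : Function.Bijective (symToGrV m n E) :=
  ⟨(mapTG_comp_symToGrV_bijective m n E).1.of_comp, symToGr_surjective _ _⟩

theorem mapTG_bijective : Function.Bijective (mapTG m n E) :=
  ((symToGrV_bijective m n E).of_comp_iff _).1 (mapTG_comp_symToGrV_bijective m n E)

theorem mapT_bijective : Function.Bijective (mapT m n E) :=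
  ⟨injective_of_grMap_injective ((mapT m n E).restrictScalars ℂ) (filtV_le_comap m n E)
      (exists_mem_filt hAlg_decomp) (mapTG_bijective m n E).1,
    surjective_of_grMap_surjective ((mapT m n E).restrictScalars ℂ) (filtV_le_comap m n E)
      (exists_mem_filt gPrime_decomp) (mapTG_bijective m n E).2⟩

end OscRestriction

end

theorem mainTheorem3 (m n : ℕ) (E : Type*) [AddCommGroup E] [Module ℂ E] [FiniteDimensional ℂ E]
    [LieRingModule (OscRestriction.kPrime m n) E]
    [LieModule ℂ (OscRestriction.kPrime m n) E] :
    Function.Bijective (OscRestriction.mapT m n E) ∧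
    ∃ hT : ∀ k, OscRestriction.filtV m n E k ≤
        (OscRestriction.filtVPlus m n E k).comap ((OscRestriction.mapT m n E).restrictScalars ℂ),
      Function.Bijective
        (OscRestriction.grMap ((OscRestriction.mapT m n E).restrictScalars ℂ) hT) ∧
      (∀ (a : SymmetricAlgebra ℂ (OscRestriction.pAlg m n))
          (x : OscRestriction.Gr (OscRestriction.filtV m n E)),
        OscRestriction.grMap ((OscRestriction.mapT m n E).restrictScalars ℂ) hT
            (OscRestriction.symActV m n E a x) =
          OscRestriction.symActVPlus m n E
            (OscRestriction.symMap (OscRestriction.pEquiv m n).toLinearMap a)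
            (OscRestriction.grMap ((OscRestriction.mapT m n E).restrictScalars ℂ) hT x)) ∧
      Function.Bijective (OscRestriction.symToGrV m n E) ∧
      Function.Bijective (OscRestriction.symToGrVPlus m n E) ∧
      ∀ (a : SymmetricAlgebra ℂ (OscRestriction.pAlg m n)) (e : E),
        OscRestriction.grMap ((OscRestriction.mapT m n E).restrictScalars ℂ) hT
            (OscRestriction.symToGrV m n E (a ⊗ₜ[ℂ] e)) =
          OscRestriction.symToGrVPlus m n E
            (OscRestriction.symMap (OscRestriction.pEquiv m n).toLinearMap a ⊗ₜ[ℂ] e) := by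
  exact ⟨OscRestriction.mapT_bijective m n E, OscRestriction.filtV_le_comap m n E,
    OscRestriction.mapTG_bijective m n E, OscRestriction.mapTG_symActV m n E,
    OscRestriction.symToGrV_bijective m n E, OscRestriction.symToGrVPlus_bijective m n E,
    OscRestriction.mapTG_symToGrV m n E⟩
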